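/- **Theorem 3.1.** There is an absolute constant $C>0$ with the following property. Let $n,N\ge 1$, let $a_1,\dots,a_N\in\mathbb R^n$, and let $A$ be the $N\times n$ matrix with rows $a_1,\dots,a_N$. Let $b\in(0,1)$, let $\delta_1,\dots,\delta_N$ be i.i.d. real random variables with $\sup_{x\in\mathbb R}\mathbb P(|\delta_i-x|\le 1)\le 1-b$, and put $X=\sum_{k=1}^N\delta_k a_k$. For $\alpha>0$ and $\gamma\in(0,1)$ let $$\mathrm{LCD}_{\alpha,\gamma}(A)=\inf\Big\{|\theta|_2:\ \theta\in\mathbb R^n,\ d_2(A\theta,\mathbb Z^N)<\min(\gamma|A\theta|_2,\alpha)\Big\},$$ where $|\cdot|_2$ is the Euclidean norm and $d_2$ the Euclidean distance. Assume that $|A\theta|_2\ge|\theta|_2$ for all $\theta\in\mathbb R^n$ and that $t\ge \sqrt n/\mathrm{LCD}_{\alpha,\gamma}(A)$. (i) Let $\|\cdot\|$ be a Borel measurable quasi-norm on $\mathbb R^n$ with unit ball $K=\{x:\|x\|\le 1\}$, and let $C_K$ be a constant such that $\|x+y\|\le C_K(\|x\|+\|y\|)$ for all $x,y\in\mathbb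 R^n$. Then $$\mathbb P(\|X\|\le t)\le \frac{|K|}{\gamma_n(K)}\left(\frac{C\,C_K}{\pi}\right)^n\left(\left(\frac{t}{\gamma\sqrt b}\right)^n+e^{-b\alpha^2}\right),$$ where $|K|$ is the Lebesgue measure and $\gamma_n(K)$ the standard Gaussian measure of $K$. (ii) For every $p>0$, with $|x|_p=\big(\sum_{j=1}^n|x_j|^p\big)^{1/p}$ and $C_p=\max\{2^{1/p-1},1\}$, $$\mathbb P\big(|X|_p\le t\,n^{1/p}\big)\le (C\cdot C_p)^n\left(\left(\frac{t}{\gamma\sqrt b}\right)^n+e^{-b\alpha^2}\right).$$ -/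

import Mathlib

open MeasureTheory ProbabilityTheory
open scoped Matrix

/-- `q` is a quasi-norm on `ℝⁿ` satisfying the quasi-triangle inequality with constant `CK`. -/
structure IsQuasiNorm {n : ℕ} (q : EuclideanSpace ℝ (Fin n) → ℝ) (CK : ℝ) : Prop where
  nonneg : ∀ x, 0 ≤ q x
  eq_zero_iff : ∀ x, q x = 0 ↔ x = 0
  smul : ∀ (c : ℝ) (x : EuclideanSpace ℝ (Fin n)), q (c • x) = |c| * q x
  add_le : ∀ x y, q (x + y) ≤ CK * (q x + q y)

/-- The unit ball `K = {x : ‖x‖ ≤ 1}` of a quasi-norm. -/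
def quasiBall {n : ℕ} (q : EuclideanSpace ℝ (Fin n) → ℝ) : Set (EuclideanSpace ℝ (Fin n)) :=
  {x | q x ≤ 1}

/-- The vector `A θ` of `ℝᴺ`, carrying the Euclidean norm. -/
noncomputable def euclMulVec {n N : ℕ} (A : Matrix (Fin N) (Fin n) ℝ)
    (θ : EuclideanSpace ℝ (Fin n)) : EuclideanSpace ℝ (Fin N) :=
  WithLp.toLp 2 (A *ᵥ θ.ofLp)

/-- The integer lattice `ℤᴺ` inside `ℝᴺ`. -/
def intLattice (N : ℕ) : Set (EuclideanSpace ℝ (Fin N)) :=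
  {m | ∀ i, ∃ k : ℤ, m i = (k : ℝ)}

/-- The vectors `θ` over which the least common denominator is the infimum of `|θ|₂`. -/
def lcdSet {n N : ℕ} (α γ : ℝ) (A : Matrix (Fin N) (Fin n) ℝ) :
    Set (EuclideanSpace ℝ (Fin n)) :=
  {θ | Metric.infDist (euclMulVec A θ) (intLattice N) < min (γ * ‖euclMulVec A θ‖) α}

/-- The least common denominator of the matrix `A`. If `n ≥ 1` and `|A θ|₂ ≥ |θ|₂` for all `θ`
(and `α > 0`, `0 < γ < 1`), then the set of norms is non-empty and its infimum is positive, so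
that the real infimum is the usual one. -/
noncomputable def LCD {n N : ℕ} (α γ : ℝ) (A : Matrix (Fin N) (Fin n) ℝ) : ℝ :=
  sInf ((fun θ : EuclideanSpace ℝ (Fin n) => ‖θ‖) '' lcdSet α γ A)

/-- The random vector `X = ∑ₖ δₖ aₖ`, where `aₖ` is the `k`-th row of `A`. -/
noncomputable def loSum {n N : ℕ} {Ω : Type*} (A : Matrix (Fin N) (Fin n) ℝ)
    (δ : Fin N → Ω → ℝ) (ω : Ω) : EuclideanSpace ℝ (Fin n) :=
  ∑ k, δ k ω • (WithLp.toLp 2 (A k) : EuclideanSpace ℝ (Fin n))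

/-- The `ℓ_p` quasi-norm `|x|_p = (∑ⱼ |xⱼ|^p)^(1/p)`. -/
noncomputable def lpQuasiNorm {n : ℕ} (p : ℝ) (x : EuclideanSpace ℝ (Fin n)) : ℝ :=
  (∑ j, |x j| ^ p) ^ (1 / p)

/-! The proof is Esseen's method with Gaussian smoothing. For a probability measure `μ`, the density
of `μ * γ_n` is at most `M = (2π)⁻ⁿ ∫ |φ_μ(u)| exp(-|u|²/2) du` by Fourier inversion. So `μ(U)
γ_n(S) ≤ M |W|` whenever `U + S ⊆ W` (`measureReal_mul_stdGaussian_le`). Everything reduces to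
bounding that integral for the law `μ` of `X / t`.

The characteristic function factors over the `δ_k`. Symmetrizing each factor, keeping only
differences `|z| > 1` (mass at least `b`) and applying Jensen bounds the product by an average over
such `z` of `exp(-4 b W(z u / (2 π t))²)`, where `W(θ) = d₂(Aθ, ℤᴺ)` (`prod_norm_charFun_le`).

For fixed `z`, the `u`-integral is localized to cubes of side `2/|z|`. Rescaled differences of
points of such a cube are shorter than the LCD, so there `W` is at least `min(γ|θ|, α)`.
Subadditivity of `W` compares each point of the cube with the minimizer of `W` on it. This gives a
Gaussian integral, the source of `(t / (γ√b))ⁿ`, plus the volume of the cube times `exp(-bα²)`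
(`setIntegral_exp_neg_sq_le`, `integral_exp_neg_sq_mul_gaussian_le`).

For (i), take `U = S = K` and `W = 2 C_K K`. For (ii), the ball `∑ |x_j|^p ≤ n` is covered by
translates of `[-1,1]ⁿ` centred at its own integer points. Each translate is handled by the
smoothing inequality, and the number of centres is at most `(c 2^(1/p))ⁿ` with `c` absolute
(`card_filter_sum_rpow_le`). -/

/-! ### Gaussian integrals and the smoothing inequality. -/

open scoped RealInnerProductSpace in
theorem integral_cexp_gaussian_fourier {n : ℕ} (y : EuclideanSpace ℝ (Fin n)) :
    ∫ u : EuclideanSpace ℝ (Fin n),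
        Complex.exp (-(((1 / 2 : ℝ) : ℂ)) * (‖u‖ : ℂ) ^ 2 + Complex.I * (⟪y, u⟫ : ℝ)) =
      ((Real.sqrt (2 * Real.pi) ^ n * Real.exp (-(1 / 2) * ‖y‖ ^ 2) : ℝ) : ℂ) := by
  rw [GaussianFourier.integral_cexp_neg_mul_sq_norm_add (by simp) Complex.I y]
  have h1 : ((Real.pi : ℂ) / ((1 / 2 : ℝ) : ℂ)) = ((2 * Real.pi : ℝ) : ℂ) := by
    push_cast; ring
  rw [h1, finrank_euclideanSpace_fin]
  push_cast
  congr 1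
  · have : (2 * (Real.pi : ℂ)) = ((2 * Real.pi : ℝ) : ℂ) := by push_cast; ring
    rw [this, show ((n : ℂ) / 2) = (((n : ℝ) / 2 : ℝ) : ℂ) by push_cast; ring,
      ← Complex.ofReal_cpow (by positivity), Real.sqrt_eq_rpow, ← Complex.ofReal_pow,
      ← Real.rpow_mul_natCast (by positivity)]
    congr 2; ring
  · congr 1
    rw [Complex.I_sq]; ring

theorem integrable_exp_neg_mul_norm_sq {n : ℕ} {c : ℝ} (hc : 0 < c) :
    Integrable (fun u : EuclideanSpace ℝ (Fin n) => Real.exp (-c * ‖u‖ ^ 2)) := by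
  have h := (GaussianFourier.integrable_cexp_neg_mul_sq_norm_add (b := (c : ℂ)) (by simpa using hc) 0
    (0 : EuclideanSpace ℝ (Fin n))).re
  refine h.congr (Filter.Eventually.of_forall fun u => ?_)
  simp only [zero_mul, add_zero]
  have : (-(c : ℂ) * (‖u‖ : ℂ) ^ 2) = ((-c * ‖u‖ ^ 2 : ℝ) : ℂ) := by push_cast; ring
  rw [this, ← Complex.ofReal_exp]
  exact Complex.ofReal_re _

theorem integral_exp_neg_mul_norm_sq {n : ℕ} {c : ℝ} (hc : 0 < c) :
    ∫ u : EuclideanSpace ℝ (Fin n), Real.exp (-c * ‖u‖ ^ 2) = Real.sqrt (Real.pi / c) ^ n := by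
  rw [GaussianFourier.integral_rexp_neg_mul_sq_norm hc, finrank_euclideanSpace_fin,
    Real.sqrt_eq_rpow, ← Real.rpow_mul_natCast (by positivity)]
  congr 1; ring

theorem stdGaussian_eq_withDensity (n : ℕ) :
    stdGaussian (EuclideanSpace ℝ (Fin n)) = volume.withDensity (fun x =>
      ENNReal.ofReal ((Real.sqrt (2 * Real.pi) ^ n)⁻¹ * Real.exp (-(1 / 2) * ‖x‖ ^ 2))) := by
  have hint := (integrable_exp_neg_mul_norm_sq (n := n) (c := 1 / 2) (by norm_num)).const_mul
    (Real.sqrt (2 * Real.pi) ^ n)⁻¹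
  have : IsFiniteMeasure ((volume : Measure (EuclideanSpace ℝ (Fin n))).withDensity (fun x =>
      ENNReal.ofReal ((Real.sqrt (2 * Real.pi) ^ n)⁻¹ * Real.exp (-(1 / 2) * ‖x‖ ^ 2)))) :=
    isFiniteMeasure_withDensity_ofReal hint.2
  apply Measure.ext_of_charFun
  ext t
  rw [charFun_stdGaussian, charFun_apply, integral_withDensity_eq_integral_toReal_smul
    (by fun_prop) (by simp)]
  have h := integral_cexp_gaussian_fourier t
  have hs : (Real.sqrt (2 * Real.pi) : ℂ) ^ n ≠ 0 := by
    have : Real.sqrt (2 * Real.pi) ≠ 0 := by positivity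
    exact pow_ne_zero _ (by exact_mod_cast this)
  have h2 : ∀ x : EuclideanSpace ℝ (Fin n),
      (ENNReal.ofReal ((Real.sqrt (2 * Real.pi) ^ n)⁻¹ * Real.exp (-(1 / 2) * ‖x‖ ^ 2))).toReal •
        Complex.exp ((inner ℝ x t : ℝ) * Complex.I) =
      ((Real.sqrt (2 * Real.pi) : ℂ) ^ n)⁻¹ *
        Complex.exp (-(((1 / 2 : ℝ) : ℂ)) * (‖x‖ : ℂ) ^ 2 + Complex.I * (inner ℝ t x : ℝ)) := by
    intro x
    rw [ENNReal.toReal_ofReal (by positivity), Complex.exp_add, real_inner_comm x t,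
      Complex.real_smul]
    push_cast
    ring_nf
  simp_rw [h2]
  rw [integral_const_mul, h]
  push_cast
  rw [← mul_assoc, inv_mul_cancel₀ hs, one_mul]
  congr 1; ring

/-- The Gaussian is its own Fourier transform up to a constant: write the kernel as an integral over
frequencies `u`, swap with `μ`, and the inner integral is a phase times `charFun μ (-u)`. -/
theorem integral_gaussianKernel_le {n : ℕ} (μ : Measure (EuclideanSpace ℝ (Fin n)))
    [IsProbabilityMeasure μ] (w : EuclideanSpace ℝ (Fin n)) :
    ∫ x, (Real.sqrt (2 * Real.pi) ^ n)⁻¹ * Real.exp (-(1 / 2) * ‖w - x‖ ^ 2) ∂μ ≤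
      ((2 * Real.pi) ^ n)⁻¹ * ∫ u, ‖charFun μ u‖ * Real.exp (-(1 / 2) * ‖u‖ ^ 2) := by
  set s : ℝ := Real.sqrt (2 * Real.pi) ^ n with hs
  have hs0 : 0 < s := by positivity
  have hss : ((2 * Real.pi) ^ n) = s * s := by
    rw [hs, ← mul_pow, Real.mul_self_sqrt (by positivity)]
  have hI : Integrable (fun p : EuclideanSpace ℝ (Fin n) × EuclideanSpace ℝ (Fin n) =>
      Complex.exp (-(((1 / 2 : ℝ) : ℂ)) * (‖p.2‖ : ℂ) ^ 2 +
        Complex.I * (inner ℝ (w - p.1) p.2 : ℝ))) (μ.prod volume) := by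
    have h1 := Integrable.mul_prod (μ := μ) (ν := (volume : Measure (EuclideanSpace ℝ (Fin n))))
      (f := fun _ => (1 : ℝ)) (integrable_const 1)
      (integrable_exp_neg_mul_norm_sq (n := n) (c := 1 / 2) (by norm_num))
    refine h1.mono' (by fun_prop) (Filter.Eventually.of_forall fun p => ?_)
    rw [Complex.norm_exp]
    simp [← Complex.ofReal_pow]
  have hswap := integral_integral_swap (f := fun x u => Complex.exp (-(((1 / 2 : ℝ) : ℂ)) *
    (‖u‖ : ℂ) ^ 2 + Complex.I * (inner ℝ (w - x) u : ℝ))) hI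
  simp_rw [integral_cexp_gaussian_fourier] at hswap
  have hinner : ∀ u : EuclideanSpace ℝ (Fin n), ∫ x, Complex.exp (-(((1 / 2 : ℝ) : ℂ)) * (‖u‖ : ℂ) ^ 2 +
        Complex.I * (inner ℝ (w - x) u : ℝ)) ∂μ =
      Complex.exp (-(((1 / 2 : ℝ) : ℂ)) * (‖u‖ : ℂ) ^ 2 + Complex.I * (inner ℝ w u : ℝ)) *
        charFun μ (-u) := by
    intro u
    rw [charFun_apply, ← integral_const_mul]
    congr 1; ext x
    rw [← Complex.exp_add]
    congr 1
    rw [inner_sub_left, inner_neg_right]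
    push_cast; ring
  simp_rw [hinner] at hswap
  rw [integral_complex_ofReal] at hswap
  have hnorm := congrArg norm hswap
  rw [Complex.norm_real] at hnorm
  have hle : ∫ x, s * Real.exp (-(1 / 2) * ‖w - x‖ ^ 2) ∂μ ≤
      ∫ u, ‖charFun μ u‖ * Real.exp (-(1 / 2) * ‖u‖ ^ 2) := by
    refine (le_abs_self _).trans ?_
    rw [← Real.norm_eq_abs, hnorm]
    refine (norm_integral_le_integral_norm _).trans (le_of_eq ?_)
    congr 1; ext u
    rw [norm_mul, charFun_neg, RCLike.norm_conj, Complex.norm_exp, mul_comm]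
    simp [← Complex.ofReal_pow]
  rw [integral_const_mul] at hle ⊢
  rw [hss, mul_inv, mul_assoc]
  refine mul_le_mul_of_nonneg_left ?_ (by positivity)
  rwa [le_inv_mul_iff₀ hs0]

/-- If `x` has law `μ` and `s` is an independent Gaussian, then `x ∈ U` and `s ∈ S` force `x + s ∈
W`, and `x + s` has a density bounded by the Fourier integral. -/
theorem measureReal_mul_stdGaussian_le {n : ℕ} (μ : Measure (EuclideanSpace ℝ (Fin n)))
    [IsProbabilityMeasure μ] {U S W : Set (EuclideanSpace ℝ (Fin n))} (hW : MeasurableSet W)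
    (hWfin : volume W ≠ ⊤) (hUSW : ∀ x ∈ U, ∀ s ∈ S, x + s ∈ W) :
    μ.real U * (stdGaussian (EuclideanSpace ℝ (Fin n))).real S ≤
      volume.real W * (((2 * Real.pi) ^ n)⁻¹ *
        ∫ u, ‖charFun μ u‖ * Real.exp (-(1 / 2) * ‖u‖ ^ 2)) := by
  set M : ℝ := ((2 * Real.pi) ^ n)⁻¹ * ∫ u, ‖charFun μ u‖ * Real.exp (-(1 / 2) * ‖u‖ ^ 2) with hM
  have hM0 : 0 ≤ M := mul_nonneg (by positivity) (integral_nonneg fun u => by positivity)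
  set g : EuclideanSpace ℝ (Fin n) → ENNReal := fun x =>
      ENNReal.ofReal ((Real.sqrt (2 * Real.pi) ^ n)⁻¹ * Real.exp (-(1 / 2) * ‖x‖ ^ 2)) with hg
  have hgm : Measurable g := by fun_prop
  set G := stdGaussian (EuclideanSpace ℝ (Fin n)) with hG
  have hbound : ∀ w, ∫⁻ x, g (w - x) ∂μ ≤ ENNReal.ofReal M := by
    intro w
    rw [hg]
    dsimp only
    rw [← ofReal_integral_eq_lintegral_ofReal]
    · exact ENNReal.ofReal_le_ofReal (integral_gaussianKernel_le μ w)
    · refine Integrable.of_bound (C := (Real.sqrt (2 * Real.pi) ^ n)⁻¹) (by fun_prop)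
        (Filter.Eventually.of_forall fun x => ?_)
      rw [Real.norm_of_nonneg (by positivity)]
      refine mul_le_of_le_one_right (by positivity) (Real.exp_le_one_iff.2 ?_)
      nlinarith [sq_nonneg ‖w - x‖]
    · exact Filter.Eventually.of_forall fun x => by positivity
  have key : μ U * G S ≤ ENNReal.ofReal M * volume W := by
    have hmeas : MeasurableSet {p : EuclideanSpace ℝ (Fin n) × EuclideanSpace ℝ (Fin n) |
        p.1 + p.2 ∈ W} := measurable_add hW
    calc μ U * G S = (μ.prod G) (U ×ˢ S) := (Measure.prod_prod _ _).symm
      _ ≤ (μ.prod G) {p | p.1 + p.2 ∈ W} :=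
          measure_mono fun p hp => hUSW p.1 hp.1 p.2 hp.2
      _ = ∫⁻ x, ∫⁻ w in W, g (w - x) ∂volume ∂μ := by
          rw [Measure.prod_apply hmeas]
          congr 1; ext x
          have hm : MeasurableSet (Prod.mk x ⁻¹'
              {p : EuclideanSpace ℝ (Fin n) × EuclideanSpace ℝ (Fin n) | p.1 + p.2 ∈ W}) :=
            measurable_prodMk_left hmeas
          rw [hG, stdGaussian_eq_withDensity, withDensity_apply _ hm, ← lintegral_indicator hm,
            ← lintegral_indicator hW,
            ← lintegral_add_left_eq_self (μ := volume) (W.indicator fun w => g (w - x)) x]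
          congr 1; ext y
          by_cases hy : x + y ∈ W
          · rw [Set.indicator_of_mem (by exact hy), Set.indicator_of_mem hy, add_sub_cancel_left]
          · rw [Set.indicator_of_notMem (by exact hy), Set.indicator_of_notMem hy]
      _ = ∫⁻ w in W, ∫⁻ x, g (w - x) ∂μ ∂volume :=
          lintegral_lintegral_swap (by fun_prop)
      _ ≤ ∫⁻ w in W, ENNReal.ofReal M := lintegral_mono fun w => hbound w
      _ = ENNReal.ofReal M * volume W := by simp
  have := ENNReal.toReal_mono (ENNReal.mul_ne_top ENNReal.ofReal_ne_top hWfin) key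
  rw [ENNReal.toReal_mul, ENNReal.toReal_mul, ENNReal.toReal_ofReal hM0] at this
  rw [mul_comm (volume.real W)]
  exact this

/-! ### Characteristic functions and the distance to the integer lattice. -/

theorem eight_mul_sub_round_sq_le (x : ℝ) :
    8 * (x - round x) ^ 2 ≤ 1 - Real.cos (2 * Real.pi * x) := by
  have h := abs_sub_round x
  have hpi := Real.pi_pos
  have h1 : Real.cos (2 * Real.pi * x) = Real.cos (2 * Real.pi * (x - round x)) := by
    rw [← Real.cos_sub_int_mul_two_pi (2 * Real.pi * x) (round x)]
    congr 1; ring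
  have h2 : |2 * Real.pi * (x - round x)| ≤ Real.pi := by
    rw [abs_mul, abs_of_pos (by positivity)]; nlinarith
  have h3 := Real.cos_le_one_sub_mul_cos_sq h2
  rw [h1]
  have h4 : 2 / Real.pi ^ 2 * (2 * Real.pi * (x - round x)) ^ 2 = 8 * (x - round x) ^ 2 := by
    field_simp; ring
  linarith

theorem infDist_intLattice_sq_le {N : ℕ} (x : EuclideanSpace ℝ (Fin N)) :
    8 * Metric.infDist x (intLattice N) ^ 2 ≤ ∑ k, (1 - Real.cos (2 * Real.pi * x k)) := by
  set m : EuclideanSpace ℝ (Fin N) := WithLp.toLp 2 fun k => (round (x k) : ℝ) with hm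
  have h1 : Metric.infDist x (intLattice N) ≤ dist x m :=
    Metric.infDist_le_dist_of_mem fun i => ⟨round (x i), rfl⟩
  have h2 : dist x m ^ 2 = ∑ k, (x k - round (x k)) ^ 2 := by
    rw [dist_eq_norm, EuclideanSpace.norm_sq_eq]
    simp [hm]
  calc 8 * Metric.infDist x (intLattice N) ^ 2 ≤ 8 * dist x m ^ 2 := by
        gcongr
        exact Metric.infDist_nonneg
    _ = ∑ k, 8 * (x k - round (x k)) ^ 2 := by rw [h2, Finset.mul_sum]
    _ ≤ _ := Finset.sum_le_sum fun k _ => eight_mul_sub_round_sq_le _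

/-- The law of the difference of two independent variables of law `ν`. -/
noncomputable def symmetrization (ν : Measure ℝ) : Measure ℝ :=
  (ν.prod ν).map fun p => p.1 - p.2

instance isProbabilityMeasure_symmetrization (ν : Measure ℝ) [IsProbabilityMeasure ν] :
    IsProbabilityMeasure (symmetrization ν) :=
  Measure.isProbabilityMeasure_map (by fun_prop)

theorem norm_charFun_sq_eq_integral_cos (ν : Measure ℝ) [IsProbabilityMeasure ν] (s : ℝ) :
    ‖charFun ν s‖ ^ 2 = ∫ z, Real.cos (s * z) ∂(symmetrization ν) := by
  have h1 : ((‖charFun ν s‖ ^ 2 : ℝ) : ℂ) = charFun ν s * charFun ν (-s) := by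
    rw [charFun_neg, Complex.mul_conj, Complex.normSq_eq_norm_sq]
  have h2 : charFun ν s * charFun ν (-s) =
      ∫ p : ℝ × ℝ, Complex.exp ((s * (p.1 - p.2) : ℝ) * Complex.I) ∂(ν.prod ν) := by
    rw [charFun_apply_real, charFun_apply_real, ← integral_prod_mul]
    congr 1; ext p
    rw [← Complex.exp_add]
    congr 1; push_cast; ring
  have hint : Integrable (fun p : ℝ × ℝ => Complex.exp ((s * (p.1 - p.2) : ℝ) * Complex.I))
      (ν.prod ν) :=
    Integrable.of_bound (C := 1) (by fun_prop)
      (Filter.Eventually.of_forall fun p => by rw [Complex.norm_exp_ofReal_mul_I])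
  have h3 := integral_re hint
  rw [← h2, ← h1] at h3
  simp only [RCLike.re_to_complex, Complex.exp_ofReal_mul_I_re, Complex.ofReal_re] at h3
  rw [← h3, symmetrization, integral_map (by fun_prop) (by fun_prop)]

/-- With `a = |φ(s)|`, the inequality `a² ≤ exp(-(1 - a²))` is `1 + x ≤ exp x`, and `a²` is the mean
of the cosine under the symmetrized law. -/
theorem norm_charFun_le_exp (ν : Measure ℝ) [IsProbabilityMeasure ν] (s : ℝ) :
    ‖charFun ν s‖ ≤ Real.exp (-(1 / 2) * ∫ z, (1 - Real.cos (s * z)) ∂(symmetrization ν)) := by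
  have hint : Integrable (fun z => Real.cos (s * z)) (symmetrization ν) :=
    Integrable.of_bound (C := 1) (by fun_prop)
      (Filter.Eventually.of_forall fun p => Real.abs_cos_le_one _)
  rw [integral_sub (integrable_const _) hint, ← norm_charFun_sq_eq_integral_cos]
  simp only [integral_const, probReal_univ, smul_eq_mul, mul_one]
  set a := ‖charFun ν s‖
  have ha : 0 ≤ a := norm_nonneg _
  refine abs_le_of_sq_le_sq' ?_ (Real.exp_nonneg _) |>.2
  rw [← Real.exp_nat_mul]
  have := Real.add_one_le_exp (((2 : ℕ) : ℝ) * (-(1 / 2) * (1 - a ^ 2)))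
  push_cast at this ⊢
  linarith

/-- Freeze one of the two independent copies at `y`; the other lies within `1` of `y` with
probability at most `1 - b`. -/
theorem le_symmetrization_one_lt_abs (ν : Measure ℝ) [IsProbabilityMeasure ν] {b : ℝ} (hb1 : b < 1)
    (h : ∀ x : ℝ, ν.real {y | |y - x| ≤ 1} ≤ 1 - b) :
    b ≤ (symmetrization ν).real {z | 1 < |z|} := by
  have hm : MeasurableSet {z : ℝ | 1 < |z|} := measurableSet_lt measurable_const (by fun_prop)
  have hc : {z : ℝ | 1 < |z|}ᶜ = {z | |z| ≤ 1} := by ext; simp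
  have h1 := probReal_compl_eq_one_sub (μ := symmetrization ν) hm
  rw [hc] at h1
  suffices (symmetrization ν).real {z | |z| ≤ 1} ≤ 1 - b by linarith
  have hm' : MeasurableSet {z : ℝ | |z| ≤ 1} := measurableSet_le (by fun_prop) measurable_const
  refine ENNReal.toReal_le_of_le_ofReal (by linarith) ?_
  rw [symmetrization, Measure.map_apply (by fun_prop) hm', Measure.prod_apply_symm
    (measurableSet_preimage (by fun_prop) hm')]
  calc _ ≤ ∫⁻ _, ENNReal.ofReal (1 - b) ∂ν := by
        refine lintegral_mono fun y => ?_
        rw [← ENNReal.ofReal_toReal (measure_ne_top ν _)]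
        exact ENNReal.ofReal_le_ofReal (h y)
    _ = _ := by simp

theorem continuous_infDist_smul {N : ℕ} (s : EuclideanSpace ℝ (Fin N)) :
    Continuous fun z : ℝ => Metric.infDist ((z / (2 * Real.pi)) • s) (intLattice N) :=
  (Metric.continuous_infDist_pt _).comp (by fun_prop)

/-- All coordinates share the law `ν`, so the exponents add under a single integral in `z`.
Discarding `|z| ≤ 1` costs only the factor `b`, and Jensen's inequality takes the conditional mean
out of the exponential. -/
theorem prod_norm_charFun_le {N : ℕ} (ν : Measure ℝ) [IsProbabilityMeasure ν] {b : ℝ} (hb : 0 < b)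
    (hb1 : b < 1) (h : ∀ x : ℝ, ν.real {y | |y - x| ≤ 1} ≤ 1 - b) (s : EuclideanSpace ℝ (Fin N)) :
    ∏ k, ‖charFun ν (s k)‖ ≤
      ∫ z, Real.exp (-(4 * b * Metric.infDist ((z / (2 * Real.pi)) • s) (intLattice N) ^ 2))
        ∂((symmetrization ν)[|{z : ℝ | 1 < |z|}]) := by
  set ρ := symmetrization ν with hρ
  set T : Set ℝ := {z : ℝ | 1 < |z|} with hT
  have hTm : MeasurableSet T := measurableSet_lt measurable_const (by fun_prop)
  have hbT : b ≤ ρ.real T := le_symmetrization_one_lt_abs ν hb1 h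
  have hT0 : ρ T ≠ 0 := by
    intro h0
    have : ρ.real T = 0 := by simp [Measure.real, h0]
    linarith
  have : IsProbabilityMeasure (ρ[|T]) := cond_isProbabilityMeasure hT0
  set w : ℝ → ℝ := fun z => Metric.infDist ((z / (2 * Real.pi)) • s) (intLattice N) with hw
  have hwc : Continuous w := continuous_infDist_smul s
  have hsum : ∀ z, 8 * w z ^ 2 ≤ ∑ k, (1 - Real.cos (s k * z)) := by
    intro z
    refine (infDist_intLattice_sq_le _).trans (le_of_eq ?_)
    refine Finset.sum_congr rfl fun k _ => ?_
    congr 2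
    simp only [PiLp.smul_apply, smul_eq_mul]
    field_simp
  have hcosint : ∀ k, Integrable (fun z => 1 - Real.cos (s k * z)) ρ := fun k =>
    Integrable.of_bound (C := 2) (by fun_prop) (Filter.Eventually.of_forall fun z => by
      rw [Real.norm_eq_abs, abs_le]
      constructor <;> linarith [Real.neg_one_le_cos (s k * z), Real.cos_le_one (s k * z)])
  have hsumint : Integrable (fun z => ∑ k, (1 - Real.cos (s k * z))) ρ :=
    integrable_finsetSum _ fun k _ => hcosint k
  have hsum0 : ∀ z, 0 ≤ ∑ k, (1 - Real.cos (s k * z)) := fun z =>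
    Finset.sum_nonneg fun k _ => by linarith [Real.cos_le_one (s k * z)]
  have hwb : ∀ z, w z ^ 2 ≤ N := by
    intro z
    have h1 : ∑ k, (1 - Real.cos (s k * z)) ≤ ∑ _k : Fin N, (2 : ℝ) :=
      Finset.sum_le_sum fun k _ => by linarith [Real.neg_one_le_cos (s k * z)]
    simp only [Finset.sum_const, Finset.card_univ, Fintype.card_fin, nsmul_eq_mul] at h1
    have := hsum z
    have hN : (0 : ℝ) ≤ N := by positivity
    linarith
  have hwint : ∀ (μ : Measure ℝ) [IsFiniteMeasure μ], Integrable (fun z => w z ^ 2) μ :=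
    fun μ _ => Integrable.of_bound (C := N) (by fun_prop) (Filter.Eventually.of_forall fun z => by
      rw [Real.norm_of_nonneg (by positivity)]; exact hwb z)
  calc ∏ k, ‖charFun ν (s k)‖
      ≤ ∏ k, Real.exp (-(1 / 2) * ∫ z, (1 - Real.cos (s k * z)) ∂ρ) :=
        Finset.prod_le_prod (fun _ _ => norm_nonneg _) fun k _ => norm_charFun_le_exp ν (s k)
    _ = Real.exp (-(1 / 2) * ∫ z, ∑ k, (1 - Real.cos (s k * z)) ∂ρ) := by
        rw [← Real.exp_sum, ← Finset.mul_sum, integral_finsetSum _ fun k _ => hcosint k]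
    _ ≤ Real.exp (∫ z, -(4 * b * w z ^ 2) ∂(ρ[|T])) := by
        rw [Real.exp_le_exp, integral_neg, integral_const_mul]
        have h1 : ∫ z in T, 8 * w z ^ 2 ∂ρ ≤ ∫ z, ∑ k, (1 - Real.cos (s k * z)) ∂ρ :=
          (setIntegral_mono ((hwint ρ).const_mul 8).integrableOn hsumint.integrableOn hsum).trans
            (setIntegral_le_integral hsumint (Filter.Eventually.of_forall hsum0))
        have h2 : ∫ z in T, w z ^ 2 ∂ρ = ρ.real T * ∫ z, w z ^ 2 ∂(ρ[|T]) := by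
          rw [ProbabilityTheory.cond, integral_smul_measure, smul_eq_mul, ENNReal.toReal_inv,
            ← mul_assoc]
          change _ = ρ.real T * (ρ.real T)⁻¹ * _
          rw [mul_inv_cancel₀ (by linarith), one_mul]
        rw [integral_const_mul, h2] at h1
        have h3 : 0 ≤ ∫ z, w z ^ 2 ∂(ρ[|T]) := integral_nonneg fun z => by positivity
        nlinarith
    _ ≤ ∫ z, Real.exp (-(4 * b * w z ^ 2)) ∂(ρ[|T]) := by
        refine convexOn_exp.map_integral_le Real.continuous_exp.continuousOn isClosed_univ
          (Filter.Eventually.of_forall fun _ => Set.mem_univ _)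
          (((hwint _).const_mul (4 * b)).neg) ?_
        refine Integrable.of_bound (C := 1) (by simp only [Function.comp_def]; fun_prop)
          (Filter.Eventually.of_forall fun z => ?_)
        rw [Function.comp_apply, Real.norm_of_nonneg (by positivity), Real.exp_le_one_iff]
        have : 0 ≤ 4 * b * w z ^ 2 := by positivity
        linarith

/-- The cube `{x : |x_i| ≤ r for all i}`. -/
def supCube (n : ℕ) (r : ℝ) : Set (EuclideanSpace ℝ (Fin n)) := {x | ∀ i, |x i| ≤ r}

theorem isClosed_supCube (n : ℕ) (r : ℝ) : IsClosed (supCube n r) := by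
  simp only [supCube, Set.ofPred_forall]
  exact isClosed_iInter fun i => isClosed_le (by fun_prop) continuous_const

theorem norm_sq_le_of_mem_supCube {n : ℕ} {r : ℝ} {x : EuclideanSpace ℝ (Fin n)}
    (hx : x ∈ supCube n r) : ‖x‖ ^ 2 ≤ n * r ^ 2 := by
  rw [EuclideanSpace.norm_sq_eq]
  calc ∑ i, ‖x i‖ ^ 2 ≤ ∑ _i : Fin n, r ^ 2 := Finset.sum_le_sum fun i _ => by
        have := hx i
        rw [Real.norm_eq_abs]
        gcongr
    _ = n * r ^ 2 := by simp

theorem norm_le_of_mem_supCube {n : ℕ} {r : ℝ} (hr : 0 ≤ r) {x : EuclideanSpace ℝ (Fin n)}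
    (hx : x ∈ supCube n r) : ‖x‖ ≤ Real.sqrt n * r := by
  refine abs_le_of_sq_le_sq' ?_ (by positivity) |>.2
  rw [mul_pow, Real.sq_sqrt (by positivity)]
  exact norm_sq_le_of_mem_supCube hx

theorem isCompact_supCube (n : ℕ) {r : ℝ} (hr : 0 ≤ r) : IsCompact (supCube n r) :=
  Metric.isCompact_of_isClosed_isBounded (isClosed_supCube n r)
    ((Metric.isBounded_iff_subset_closedBall 0).2
      ⟨Real.sqrt n * r, fun x hx => by simpa using norm_le_of_mem_supCube hr hx⟩)

theorem volume_real_supCube (n : ℕ) {r : ℝ} (hr : 0 ≤ r) :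
    volume.real (supCube n r) = (2 * r) ^ n := by
  have h1 : supCube n r = (WithLp.ofLp (p := 2) (V := Fin n → ℝ)) ⁻¹' Set.Icc (fun _ => -r) (fun _ => r) := by
    ext x
    simp only [supCube, Set.mem_ofPred_eq, Set.mem_preimage, Set.mem_Icc, Pi.le_def, abs_le,
      forall_and]
  rw [Measure.real, h1, (PiLp.volume_preserving_ofLp (Fin n)).measure_preimage
    measurableSet_Icc.nullMeasurableSet, Real.volume_Icc_pi_toReal (fun i => by linarith)]
  simp
  ring

/-! ### Integrating the bound against the Gaussian, cube by cube. -/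

section

variable {n : ℕ} {W : EuclideanSpace ℝ (Fin n) → ℝ} {b α γ D t z : ℝ}

/-- Let `c₀` minimize `W` on the cube. Then `W(κ(c - c₀)) ≤ 2 W(κ(y + c))`, so the lower bound on
`W`, valid only near the origin, controls `W` on a cube located anywhere. The factor `4` in the
exponent absorbs the square of this `2`. -/
theorem setIntegral_exp_neg_sq_le (hWc : Continuous W)
    (hWsub : ∀ x y, W (x - y) ≤ W x + W y) (hb : 0 < b) (hα : 0 < α) (hγ : 0 < γ)
    (hWD : ∀ x, ‖x‖ < D → min (γ * ‖x‖) α ≤ W x)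
    {r : ℝ} (hr : 0 ≤ r) {κ : ℝ} (hκ : 0 < κ) (hκD : κ * (2 * (Real.sqrt n * r)) < D)
    (y : EuclideanSpace ℝ (Fin n)) :
    ∫ c in supCube n r, Real.exp (-(4 * b * W (κ • (y + c)) ^ 2)) ≤
      Real.sqrt (Real.pi / (b * γ ^ 2 * κ ^ 2)) ^ n + (2 * r) ^ n * Real.exp (-(b * α ^ 2)) := by
  have hQ := isCompact_supCube n hr
  have h0 : (0 : EuclideanSpace ℝ (Fin n)) ∈ supCube n r := fun i => by simpa using hr
  obtain ⟨c₀, hc₀, hmin⟩ := hQ.exists_isMinOn ⟨0, h0⟩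
    (f := fun c => W (κ • (y + c))) (by fun_prop)
  have hβ : 0 < b * γ ^ 2 * κ ^ 2 := by positivity
  have hpt : ∀ c ∈ supCube n r, Real.exp (-(4 * b * W (κ • (y + c)) ^ 2)) ≤
      Real.exp (-(b * γ ^ 2 * κ ^ 2) * ‖c - c₀‖ ^ 2) + Real.exp (-(b * α ^ 2)) := by
    intro c hc
    have h1 : W (κ • (c - c₀)) ≤ 2 * W (κ • (y + c)) := by
      have h2 := hWsub (κ • (y + c)) (κ • (y + c₀))
      have h3 : W (κ • (y + c₀)) ≤ W (κ • (y + c)) := hmin hc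
      rw [← smul_sub, add_sub_add_left_eq_sub] at h2
      linarith
    have hnorm : ‖κ • (c - c₀)‖ = κ * ‖c - c₀‖ := by rw [norm_smul, Real.norm_of_nonneg hκ.le]
    have h4 : ‖κ • (c - c₀)‖ < D := by
      refine lt_of_le_of_lt ?_ hκD
      rw [hnorm]
      have := norm_sub_le c c₀
      have := norm_le_of_mem_supCube hr hc
      have := norm_le_of_mem_supCube hr hc₀
      gcongr
      linarith
    have h5 := hWD _ h4
    rcases min_le_iff.1 (h5.trans h1) with h6 | h6
    · refine le_add_of_le_of_nonneg (Real.exp_le_exp.2 ?_) (Real.exp_nonneg _)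
      rw [hnorm] at h6
      have h7 : (γ * (κ * ‖c - c₀‖)) ^ 2 ≤ (2 * W (κ • (y + c))) ^ 2 := by gcongr
      nlinarith
    · refine le_add_of_nonneg_of_le (Real.exp_nonneg _) (Real.exp_le_exp.2 ?_)
      have h7 : α ^ 2 ≤ (2 * W (κ • (y + c))) ^ 2 := by gcongr
      nlinarith
  have hg : Integrable (fun c => Real.exp (-(b * γ ^ 2 * κ ^ 2) * ‖c - c₀‖ ^ 2)) :=
    (integrable_exp_neg_mul_norm_sq hβ).comp_sub_right c₀
  have hconst : IntegrableOn (fun _ : EuclideanSpace ℝ (Fin n) => Real.exp (-(b * α ^ 2)))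
      (supCube n r) := integrableOn_const hQ.measure_lt_top.ne
  calc ∫ c in supCube n r, Real.exp (-(4 * b * W (κ • (y + c)) ^ 2))
      ≤ ∫ c in supCube n r, (Real.exp (-(b * γ ^ 2 * κ ^ 2) * ‖c - c₀‖ ^ 2) +
          Real.exp (-(b * α ^ 2))) :=
        setIntegral_mono_on (ContinuousOn.integrableOn_compact hQ (by fun_prop))
          (hg.integrableOn.add hconst) hQ.measurableSet hpt
    _ = (∫ c in supCube n r, Real.exp (-(b * γ ^ 2 * κ ^ 2) * ‖c - c₀‖ ^ 2)) +
          (2 * r) ^ n * Real.exp (-(b * α ^ 2)) := by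
        rw [integral_add hg.integrableOn hconst, setIntegral_const, volume_real_supCube n hr,
          smul_eq_mul]
    _ ≤ _ := by
        gcongr
        refine (setIntegral_le_integral hg (Filter.Eventually.of_forall fun c => Real.exp_nonneg _)).trans
          (le_of_eq ?_)
        rw [integral_sub_right_eq_self (fun c => Real.exp (-(b * γ ^ 2 * κ ^ 2) * ‖c‖ ^ 2)) c₀,
          integral_exp_neg_mul_norm_sq hβ]

/-- Average the translation-invariant integral over shifts `c` in the cube. Since the cube has
half-side at most `1`, the weight at `y + c` is dominated by a wider Gaussian in `y` alone, so the
inner integral sees only `F` on a cube. -/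
theorem integral_mul_gaussian_le {F : EuclideanSpace ℝ (Fin n) → ℝ} (hFc : Continuous F)
    (hF0 : ∀ x, 0 ≤ F x) (hF1 : ∀ x, F x ≤ 1) {r : ℝ} (hr : 0 < r) (hr1 : r ≤ 1) {B : ℝ}
    (hB : ∀ y, ∫ c in supCube n r, F (y + c) ≤ B) :
    ∫ u, F u * Real.exp (-(1 / 2) * ‖u‖ ^ 2) ≤
      ((2 * r) ^ n)⁻¹ * (Real.sqrt (4 * Real.pi * Real.exp 1) ^ n * B) := by
  have hQ := isCompact_supCube n hr.le
  -- This is `|y|² ≤ 2|y + c|² + 2|c|²` together with `|c|² ≤ n`.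
  have hpt : ∀ y, ∀ c ∈ supCube n r, Real.exp (-(1 / 2) * ‖y + c‖ ^ 2) ≤
      Real.exp (n / 2) * Real.exp (-(1 / 4) * ‖y‖ ^ 2) := by
    intro y c hc
    rw [← Real.exp_add, Real.exp_le_exp]
    have h1 := norm_sq_le_of_mem_supCube hc
    have h2 : (n : ℝ) * r ^ 2 ≤ n := mul_le_of_le_one_right (by positivity) (by nlinarith)
    have h3 := parallelogram_law_with_norm ℝ (y + c) c
    have h4 : y + c - c = y := by abel
    rw [h4] at h3
    nlinarith [sq_nonneg ‖y + c + c‖]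
  set f : EuclideanSpace ℝ (Fin n) → EuclideanSpace ℝ (Fin n) → ℝ :=
    fun c y => F (y + c) * Real.exp (-(1 / 2) * ‖y + c‖ ^ 2) with hf
  have hfin : IsFiniteMeasure (volume.restrict (supCube n r)) :=
    isFiniteMeasure_restrict.2 hQ.measure_lt_top.ne
  have hI : Integrable (Function.uncurry f) ((volume.restrict (supCube n r)).prod volume) := by
    have h1 := Integrable.mul_prod (μ := volume.restrict (supCube n r))
      (ν := (volume : Measure (EuclideanSpace ℝ (Fin n))))
      (f := fun _ => Real.exp (n / 2)) (integrable_const _)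
      (integrable_exp_neg_mul_norm_sq (n := n) (c := 1 / 4) (by norm_num))
    refine h1.mono' (Continuous.aestronglyMeasurable (by unfold Function.uncurry; fun_prop)) ?_
    have h2 : ∀ᵐ p ∂((volume.restrict (supCube n r)).prod
        (volume : Measure (EuclideanSpace ℝ (Fin n)))), p.1 ∈ supCube n r :=
      Measure.quasiMeasurePreserving_fst.ae (ae_restrict_mem hQ.measurableSet)
    filter_upwards [h2] with p hp
    rw [Function.uncurry, Real.norm_of_nonneg (mul_nonneg (hF0 _) (Real.exp_nonneg _))]
    exact (mul_le_of_le_one_left (Real.exp_nonneg _) (hF1 _)).trans (hpt p.2 p.1 hp)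
  have hswap := integral_integral_swap hI
  have h1 : ∀ c, ∫ y, f c y = ∫ u, F u * Real.exp (-(1 / 2) * ‖u‖ ^ 2) := fun c =>
    integral_add_right_eq_self (fun u => F u * Real.exp (-(1 / 2) * ‖u‖ ^ 2)) c
  simp_rw [h1] at hswap
  rw [setIntegral_const, volume_real_supCube n hr.le, smul_eq_mul] at hswap
  have hB0 : 0 ≤ B := (setIntegral_nonneg hQ.measurableSet fun c _ => hF0 (0 + c)).trans (hB 0)
  have h2 : ∀ y, ∫ c in supCube n r, f c y ≤
      B * (Real.exp (n / 2) * Real.exp (-(1 / 4) * ‖y‖ ^ 2)) := by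
    intro y
    calc ∫ c in supCube n r, f c y
        ≤ ∫ c in supCube n r, F (y + c) * (Real.exp (n / 2) * Real.exp (-(1 / 4) * ‖y‖ ^ 2)) :=
          setIntegral_mono_on (ContinuousOn.integrableOn_compact hQ (by fun_prop))
            (ContinuousOn.integrableOn_compact hQ (by fun_prop)) hQ.measurableSet
            fun c hc => mul_le_mul_of_nonneg_left (hpt y c hc) (hF0 _)
      _ ≤ _ := by
          rw [integral_mul_const]
          exact mul_le_mul_of_nonneg_right (hB y) (by positivity)
  have h3 : (2 * r) ^ n * ∫ u, F u * Real.exp (-(1 / 2) * ‖u‖ ^ 2) ≤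
      Real.sqrt (4 * Real.pi * Real.exp 1) ^ n * B := by
    rw [hswap]
    refine (integral_mono hI.integral_prod_right (((integrable_exp_neg_mul_norm_sq
      (by norm_num)).const_mul _).const_mul _) h2).trans (le_of_eq ?_)
    rw [integral_const_mul, integral_const_mul, integral_exp_neg_mul_norm_sq (by norm_num),
      Real.sqrt_mul (by positivity), mul_pow, ← Real.exp_half, ← Real.exp_nat_mul, mul_comm B,
      mul_comm (Real.exp _)]
    congr 3
    · congr 1; ring
    · ring
  rw [le_inv_mul_iff₀ (by positivity)]
  exact h3

theorem integral_exp_neg_sq_mul_gaussian_le (hWc : Continuous W)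
    (hWsub : ∀ x y, W (x - y) ≤ W x + W y) (hb : 0 < b) (hα : 0 < α) (hγ : 0 < γ) (hD : 0 < D)
    (hWD : ∀ x, ‖x‖ < D → min (γ * ‖x‖) α ≤ W x) (ht : 0 < t) (htD : Real.sqrt n ≤ t * D)
    (hz : 1 < z) :
    ∫ u, Real.exp (-(4 * b * W ((z / (2 * Real.pi * t)) • u) ^ 2)) *
        Real.exp (-(1 / 2) * ‖u‖ ^ 2) ≤
      (Real.sqrt (4 * Real.pi * Real.exp 1) * (Real.sqrt Real.pi * Real.pi)) ^ n *
        ((t / (γ * Real.sqrt b)) ^ n + Real.exp (-(b * α ^ 2))) := by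
  have hpi := Real.pi_pos
  have hz0 : 0 < z := by linarith
  set κ := z / (2 * Real.pi * t) with hκdef
  have hκ : 0 < κ := by positivity
  -- The half-side `1/z` makes `z` cancel: differences in the cube, scaled by `κ`, have length at
  -- most `√n / (π t) ≤ D / π < D`, and the final bound is uniform in `z`. The assumption `z > 1` is
  -- what gives `1/z ≤ 1`.
  have hr : 0 < 1 / z := by positivity
  have hκD : κ * (2 * (Real.sqrt n * (1 / z))) < D := by
    have h1 : κ * (2 * (Real.sqrt n * (1 / z))) = Real.sqrt n / t / Real.pi := by
      rw [hκdef]; field_simp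
    rw [h1]
    have h2 : Real.sqrt n / t ≤ D := by rw [div_le_iff₀ ht]; linarith
    calc Real.sqrt n / t / Real.pi ≤ D / Real.pi := by gcongr
      _ < D := div_lt_self hD (by linarith [Real.pi_gt_three])
  have h1 := integral_mul_gaussian_le
    (F := fun u => Real.exp (-(4 * b * W (κ • u) ^ 2))) (by fun_prop)
    (fun _ => Real.exp_nonneg _) (fun u => Real.exp_le_one_iff.2 (by
      have : 0 ≤ 4 * b * W (κ • u) ^ 2 := by positivity
      linarith)) hr (by rw [div_le_one hz0]; linarith)
    (setIntegral_exp_neg_sq_le hWc hWsub hb hα hγ hWD hr.le hκ hκD)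
  refine h1.trans ?_
  have h2 : Real.sqrt (Real.pi / (b * γ ^ 2 * κ ^ 2)) =
      (2 * (1 / z)) * (Real.sqrt Real.pi * Real.pi * (t / (γ * Real.sqrt b))) := by
    rw [Real.sqrt_div' _ (by positivity), Real.sqrt_mul' _ (by positivity),
      Real.sqrt_mul' _ (by positivity), Real.sqrt_sq hγ.le, Real.sqrt_sq hκ.le, hκdef]
    field_simp
  have h3 : 1 ≤ (Real.sqrt Real.pi * Real.pi) ^ n := by
    refine one_le_pow₀ ?_
    have : 1 ≤ Real.sqrt Real.pi := Real.one_le_sqrt.2 (by linarith [Real.pi_gt_three])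
    nlinarith [Real.pi_gt_three]
  rw [h2, mul_pow (2 * (1 / z)), ← mul_add, mul_left_comm _ ((2 * (1 / z)) ^ n),
    inv_mul_cancel_left₀ (by positivity), mul_pow (Real.sqrt Real.pi * Real.pi) (t / _),
    mul_pow (Real.sqrt (4 * Real.pi * Real.exp 1)), mul_assoc (Real.sqrt (4 * Real.pi * Real.exp 1) ^ n)]
  refine mul_le_mul_of_nonneg_left ?_ (by positivity)
  rw [mul_add]
  exact add_le_add_right (le_mul_of_one_le_left (Real.exp_nonneg _) h3) _

end

/-! ### The integer lattice and the least common denominator. -/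

theorem zero_mem_intLattice (N : ℕ) : (0 : EuclideanSpace ℝ (Fin N)) ∈ intLattice N :=
  fun _ => ⟨0, by simp⟩

theorem sub_mem_intLattice {N : ℕ} {x y : EuclideanSpace ℝ (Fin N)} (hx : x ∈ intLattice N)
    (hy : y ∈ intLattice N) : x - y ∈ intLattice N := fun i => by
  obtain ⟨k, hk⟩ := hx i
  obtain ⟨l, hl⟩ := hy i
  exact ⟨k - l, by simp [hk, hl]⟩

theorem infDist_intLattice_sub_le {N : ℕ} (x y : EuclideanSpace ℝ (Fin N)) :
    Metric.infDist (x - y) (intLattice N) ≤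
      Metric.infDist x (intLattice N) + Metric.infDist y (intLattice N) := by
  refine le_of_forall_pos_lt_add fun ε hε => ?_
  have hne : (intLattice N).Nonempty := ⟨0, zero_mem_intLattice N⟩
  obtain ⟨u, hu, hxu⟩ := (Metric.infDist_lt_iff hne).1
    (lt_add_of_pos_right (Metric.infDist x (intLattice N)) (half_pos hε))
  obtain ⟨v, hv, hyv⟩ := (Metric.infDist_lt_iff hne).1
    (lt_add_of_pos_right (Metric.infDist y (intLattice N)) (half_pos hε))
  have h1 := Metric.infDist_le_dist_of_mem (x := x - y) (sub_mem_intLattice hu hv)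
  have h2 := dist_sub_sub_le x y u v
  linarith

theorem infDist_intLattice_neg {N : ℕ} (x : EuclideanSpace ℝ (Fin N)) :
    Metric.infDist (-x) (intLattice N) = Metric.infDist x (intLattice N) := by
  have h : ∀ y : EuclideanSpace ℝ (Fin N),
      Metric.infDist (-y) (intLattice N) ≤ Metric.infDist y (intLattice N) := by
    intro y
    have := infDist_intLattice_sub_le 0 y
    rwa [Metric.infDist_zero_of_mem (zero_mem_intLattice N), zero_sub, zero_add] at this
  refine le_antisymm (h x) ?_
  simpa using h (-x)

theorem norm_le_infDist_intLattice {N : ℕ} {x : EuclideanSpace ℝ (Fin N)} (hx : ‖x‖ ≤ 1 / 2) :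
    ‖x‖ ≤ Metric.infDist x (intLattice N) := by
  refine (Metric.le_infDist ⟨0, zero_mem_intLattice N⟩).2 fun m hm => ?_
  by_cases h0 : m = 0
  · simp [h0]
  have h1 : 1 ≤ ‖m‖ := by
    obtain ⟨i, hi⟩ : ∃ i, m i ≠ 0 := by
      by_contra! h
      exact h0 (by ext i; simpa using h i)
    refine le_trans ?_ (PiLp.norm_apply_le m i)
    obtain ⟨k, hk⟩ := hm i
    rw [hk] at hi ⊢
    have : k ≠ 0 := by rintro rfl; simp at hi
    rw [Real.norm_eq_abs]
    exact_mod_cast Int.one_le_abs this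
  rw [dist_comm, dist_eq_norm]
  have := norm_sub_norm_le m x
  linarith

/-- Dirichlet approximation by compactness: the fractional parts of the multiples of `x` have a
Cauchy subsequence, and the difference of two close terms is a multiple of `x` close to the lattice.
-/
theorem exists_infDist_natCast_smul_lt {N : ℕ} (x : EuclideanSpace ℝ (Fin N)) {ε : ℝ} (hε : 0 < ε) :
    ∃ m : ℕ, 1 ≤ m ∧ Metric.infDist ((m : ℝ) • x) (intLattice N) < ε := by
  set u : ℕ → EuclideanSpace ℝ (Fin N) := fun k => WithLp.toLp 2 fun i => Int.fract ((k : ℝ) * x i)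
    with hu
  have hmem : ∀ k, u k ∈ supCube N 1 := fun k i => by
    rw [hu, abs_of_nonneg (Int.fract_nonneg _)]
    exact (Int.fract_lt_one _).le
  obtain ⟨a, -, φ, hφ, hlim⟩ := (isCompact_supCube N zero_le_one).tendsto_subseq hmem
  obtain ⟨K, hK⟩ := Metric.cauchySeq_iff'.1 hlim.cauchySeq ε hε
  have hlt : φ K < φ (K + 1) := hφ (Nat.lt_succ_self K)
  refine ⟨φ (K + 1) - φ K, by omega, lt_of_le_of_lt ?_ (hK (K + 1) (Nat.le_succ K))⟩
  set w : ℕ → EuclideanSpace ℝ (Fin N) := fun k => WithLp.toLp 2 fun i => (⌊(k : ℝ) * x i⌋ : ℝ)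
    with hw
  have hwm : ∀ k, w k ∈ intLattice N := fun k i => ⟨_, rfl⟩
  refine (Metric.infDist_le_dist_of_mem (sub_mem_intLattice (hwm (φ (K + 1))) (hwm (φ K)))).trans ?_
  rw [dist_eq_norm, dist_eq_norm]
  refine le_of_eq ?_
  congr 1
  ext i
  simp only [hu, hw, Function.comp_apply, PiLp.sub_apply, PiLp.smul_apply, smul_eq_mul, Int.fract]
  rw [Nat.cast_sub hlt.le]
  ring

theorem continuous_euclMulVec {n N : ℕ} (A : Matrix (Fin N) (Fin n) ℝ) :
    Continuous (euclMulVec A) :=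
  (Matrix.toEuclideanLin A).continuous_of_finiteDimensional

theorem euclMulVec_smul {n N : ℕ} (A : Matrix (Fin N) (Fin n) ℝ) (c : ℝ)
    (θ : EuclideanSpace ℝ (Fin n)) : euclMulVec A (c • θ) = c • euclMulVec A θ :=
  (Matrix.toEuclideanLin A).map_smul c θ

theorem euclMulVec_sub {n N : ℕ} (A : Matrix (Fin N) (Fin n) ℝ)
    (θ η : EuclideanSpace ℝ (Fin n)) :
    euclMulVec A (θ - η) = euclMulVec A θ - euclMulVec A η :=
  (Matrix.toEuclideanLin A).map_sub θ η

section

variable {n N : ℕ} {A : Matrix (Fin N) (Fin n) ℝ} {α γ : ℝ}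

/-- Needed because the real infimum of the empty set is `0`, which would make the LCD degenerate. -/
theorem lcdSet_nonempty (hn : 1 ≤ n) (hα : 0 < α) (hγ : 0 < γ)
    (hA : ∀ θ : EuclideanSpace ℝ (Fin n), ‖θ‖ ≤ ‖euclMulVec A θ‖) : (lcdSet α γ A).Nonempty := by
  set e : EuclideanSpace ℝ (Fin n) := EuclideanSpace.single ⟨0, hn⟩ 1
  have he : ‖e‖ = 1 := by simp [e]
  obtain ⟨m, hm, hlt⟩ := exists_infDist_natCast_smul_lt (euclMulVec A e) (lt_min hγ hα)
  refine ⟨(m : ℝ) • e, ?_⟩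
  change Metric.infDist (euclMulVec A ((m : ℝ) • e)) _ < min (γ * ‖euclMulVec A ((m : ℝ) • e)‖) α
  refine lt_of_lt_of_le (by rwa [euclMulVec_smul]) (min_le_min_right _ ?_)
  have h1 := hA ((m : ℝ) • e)
  rw [norm_smul, he, mul_one, Real.norm_natCast] at h1
  have hm' : (1 : ℝ) ≤ m := by exact_mod_cast hm
  exact le_mul_of_one_le_right hγ.le (hm'.trans h1)

/-- Near the origin `|Aθ| < 1/2`, where the distance from `Aθ` to the lattice is `|Aθ|` itself and
so cannot be below `γ|Aθ|`. -/
theorem LCD_pos (hn : 1 ≤ n) (hα : 0 < α) (hγ : 0 < γ) (hγ1 : γ < 1)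
    (hA : ∀ θ : EuclideanSpace ℝ (Fin n), ‖θ‖ ≤ ‖euclMulVec A θ‖) : 0 < LCD α γ A := by
  obtain ⟨ε, hε, hεA⟩ := Metric.continuousAt_iff.1 ((continuous_euclMulVec A).continuousAt
    (x := 0)) (1 / 2) (by norm_num)
  have h0 : euclMulVec A 0 = 0 := (Matrix.toEuclideanLin A).map_zero
  refine hε.trans_le (le_csInf ((lcdSet_nonempty hn hα hγ hA).image _) ?_)
  rintro _ ⟨θ, hθ, rfl⟩
  by_contra! hlt
  have h1 := hεA (x := θ) (by simpa using hlt)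
  rw [h0, dist_zero_right] at h1
  have h2 := norm_le_infDist_intLattice h1.le
  have h3 : Metric.infDist (euclMulVec A θ) (intLattice N) < min (γ * ‖euclMulVec A θ‖) α := hθ
  have h4 := h3.trans_le (min_le_left _ _)
  nlinarith [norm_nonneg (euclMulVec A θ)]

theorem min_le_infDist_of_norm_lt_LCD (hγ : 0 < γ)
    (hA : ∀ θ : EuclideanSpace ℝ (Fin n), ‖θ‖ ≤ ‖euclMulVec A θ‖) (θ : EuclideanSpace ℝ (Fin n))
    (hθ : ‖θ‖ < LCD α γ A) :
    min (γ * ‖θ‖) α ≤ Metric.infDist (euclMulVec A θ) (intLattice N) := by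
  have h : θ ∉ lcdSet α γ A := fun hmem => by
    refine hθ.not_ge (csInf_le ⟨0, ?_⟩ ⟨θ, hmem, rfl⟩)
    rintro _ ⟨η, -, rfl⟩
    exact norm_nonneg _
  have h2 : ¬ (Metric.infDist (euclMulVec A θ) (intLattice N) < min (γ * ‖euclMulVec A θ‖) α) := h
  refine le_trans (min_le_min_right _ ?_) (not_lt.1 h2)
  exact mul_le_mul_of_nonneg_left (hA θ) hγ.le

end

/-! ### The Fourier integral of the random sum. -/

theorem charFun_map_smul_loSum {n N : ℕ} (A : Matrix (Fin N) (Fin n) ℝ) {Ω : Type*}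
    [MeasurableSpace Ω] {P : Measure Ω} [IsProbabilityMeasure P] {δ : Fin N → Ω → ℝ}
    (hind : iIndepFun δ P) (hδ : ∀ k, AEMeasurable (δ k) P) (c : ℝ) (u : EuclideanSpace ℝ (Fin n)) :
    charFun (P.map fun ω => c • loSum A δ ω) u =
      ∏ k, charFun (P.map (δ k)) (c * euclMulVec A u k) := by
  have h1 : (fun ω => c • loSum A δ ω) = fun ω => ∑ k, δ k ω •
      (c • (WithLp.toLp 2 (A k) : EuclideanSpace ℝ (Fin n))) := by
    ext1 ω
    simp only [loSum, Finset.smul_sum]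
    exact Finset.sum_congr rfl fun k _ => smul_comm _ _ _
  have h2 : iIndepFun (fun k ω => δ k ω •
      (c • (WithLp.toLp 2 (A k) : EuclideanSpace ℝ (Fin n)))) P :=
    hind.comp (fun k (x : ℝ) => x • (c • (WithLp.toLp 2 (A k) : EuclideanSpace ℝ (Fin n))))
      (fun k => by fun_prop)
  rw [h1, h2.charFun_map_fun_sum_eq_prod (fun k => (hδ k).smul_const _)]
  simp only [Finset.prod_apply]
  refine Finset.prod_congr rfl fun k _ => ?_
  rw [charFun_apply, charFun_apply_real, integral_map ((hδ k).smul_const _) (by fun_prop),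
    integral_map (hδ k) (by fun_prop)]
  congr 1; ext ω
  congr 2
  have h3 : inner ℝ (WithLp.toLp 2 (A k)) u = euclMulVec A u k := by
    simp [euclMulVec, Matrix.mulVec, dotProduct, PiLp.inner_apply, mul_comm]
  rw [real_inner_smul_left, real_inner_smul_left, h3]
  push_cast
  ring

section

variable {n N : ℕ} {A : Matrix (Fin N) (Fin n) ℝ} {b α γ t : ℝ}

theorem integral_exp_neg_infDist_mul_gaussian_le (hn : 1 ≤ n) (hb : 0 < b) (hα : 0 < α)
    (hγ : 0 < γ) (hγ1 : γ < 1) (hA : ∀ θ : EuclideanSpace ℝ (Fin n), ‖θ‖ ≤ ‖euclMulVec A θ‖)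
    (ht : 0 < t) (htD : Real.sqrt n ≤ t * LCD α γ A) {z : ℝ} (hz : 1 < |z|) :
    ∫ u, Real.exp (-(4 * b * Metric.infDist ((z / (2 * Real.pi)) • t⁻¹ • euclMulVec A u)
        (intLattice N) ^ 2)) * Real.exp (-(1 / 2) * ‖u‖ ^ 2) ≤
      (Real.sqrt (4 * Real.pi * Real.exp 1) * (Real.sqrt Real.pi * Real.pi)) ^ n *
        ((t / (γ * Real.sqrt b)) ^ n + Real.exp (-(b * α ^ 2))) := by
  refine le_trans (le_of_eq ?_) (integral_exp_neg_sq_mul_gaussian_le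
    (W := fun θ => Metric.infDist (euclMulVec A θ) (intLattice N))
    ((Metric.continuous_infDist_pt _).comp (continuous_euclMulVec A))
    (fun x y => by
      rw [euclMulVec_sub]; exact infDist_intLattice_sub_le _ _) hb hα hγ (LCD_pos hn hα hγ hγ1 hA)
    (fun θ hθ => min_le_infDist_of_norm_lt_LCD hγ hA θ hθ) ht htD hz)
  congr 1; ext u
  congr 5
  rw [euclMulVec_smul, smul_smul]
  -- The lattice is symmetric, so the sign of `z` is irrelevant.
  rcases abs_choice z with h | h
  · rw [h]; congr 2; field_simp
  · rw [h, ← infDist_intLattice_neg, ← neg_smul]; congr 2; field_simp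

theorem integral_norm_charFun_loSum_le (hn : 1 ≤ n) {Ω : Type*} [MeasurableSpace Ω]
    {P : Measure Ω} [IsProbabilityMeasure P] {δ : Fin N → Ω → ℝ}
    (hind : iIndepFun δ P) (hδ : ∀ k, AEMeasurable (δ k) P)
    (ν : Measure ℝ) [IsProbabilityMeasure ν] (hν : ∀ k, P.map (δ k) = ν)
    (hb : 0 < b) (hb1 : b < 1) (hconc : ∀ x : ℝ, ν.real {y | |y - x| ≤ 1} ≤ 1 - b) (hα : 0 < α)
    (hγ : 0 < γ) (hγ1 : γ < 1) (hA : ∀ θ : EuclideanSpace ℝ (Fin n), ‖θ‖ ≤ ‖euclMulVec A θ‖)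
    (ht : 0 < t) (htD : Real.sqrt n ≤ t * LCD α γ A) :
    ∫ u, ‖charFun (P.map fun ω => t⁻¹ • loSum A δ ω) u‖ * Real.exp (-(1 / 2) * ‖u‖ ^ 2) ≤
      (Real.sqrt (4 * Real.pi * Real.exp 1) * (Real.sqrt Real.pi * Real.pi)) ^ n *
        ((t / (γ * Real.sqrt b)) ^ n + Real.exp (-(b * α ^ 2))) := by
  set T : Set ℝ := {z : ℝ | 1 < |z|} with hT
  have hTm : MeasurableSet T := measurableSet_lt measurable_const (by fun_prop)
  set ρ := (symmetrization ν)[|T] with hρ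
  have hT0 : symmetrization ν T ≠ 0 := by
    intro h0
    have h1 := le_symmetrization_one_lt_abs ν hb1 hconc
    have h2 : (symmetrization ν).real T = 0 := by simp [Measure.real, h0]
    linarith
  have : IsProbabilityMeasure ρ := cond_isProbabilityMeasure hT0
  set f : EuclideanSpace ℝ (Fin n) → ℝ → ℝ := fun u z =>
    Real.exp (-(4 * b * Metric.infDist ((z / (2 * Real.pi)) • t⁻¹ • euclMulVec A u)
        (intLattice N) ^ 2)) * Real.exp (-(1 / 2) * ‖u‖ ^ 2) with hf
  have hAc := continuous_euclMulVec A
  have hfc : Continuous (Function.uncurry f) := by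
    have h1 : Continuous fun p : EuclideanSpace ℝ (Fin n) × ℝ =>
        Metric.infDist ((p.2 / (2 * Real.pi)) • t⁻¹ • euclMulVec A p.1) (intLattice N) :=
      (Metric.continuous_infDist_pt _).comp (by fun_prop)
    unfold Function.uncurry
    fun_prop
  have hfle : ∀ u z, f u z ≤ Real.exp (-(1 / 2) * ‖u‖ ^ 2) := fun u z =>
    mul_le_of_le_one_left (Real.exp_nonneg _) (Real.exp_le_one_iff.2
      (neg_nonpos.2 (by positivity)))
  have hI : Integrable (Function.uncurry f) ((volume : Measure (EuclideanSpace ℝ (Fin n))).prod ρ) := by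
    have h1 := Integrable.mul_prod (μ := (volume : Measure (EuclideanSpace ℝ (Fin n)))) (ν := ρ)
      (integrable_exp_neg_mul_norm_sq (n := n) (c := 1 / 2) (by norm_num))
      (g := fun _ => (1 : ℝ)) (integrable_const 1)
    refine h1.mono' hfc.aestronglyMeasurable (Filter.Eventually.of_forall fun p => ?_)
    rw [Function.uncurry, Real.norm_of_nonneg (by positivity), mul_one]
    exact hfle _ _
  have hpt : ∀ u, ‖charFun (P.map fun ω => t⁻¹ • loSum A δ ω) u‖ * Real.exp (-(1 / 2) * ‖u‖ ^ 2) ≤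
      ∫ z, f u z ∂ρ := by
    intro u
    rw [charFun_map_smul_loSum A hind hδ, norm_prod, hf, integral_mul_const]
    refine mul_le_mul_of_nonneg_right ?_ (Real.exp_nonneg _)
    simp_rw [hν]
    exact prod_norm_charFun_le ν hb hb1 hconc (t⁻¹ • euclMulVec A u)
  calc ∫ u, ‖charFun (P.map fun ω => t⁻¹ • loSum A δ ω) u‖ * Real.exp (-(1 / 2) * ‖u‖ ^ 2)
      ≤ ∫ u, ∫ z, f u z ∂ρ :=
        integral_mono_of_nonneg (Filter.Eventually.of_forall fun u => by positivity)
          hI.integral_prod_left (Filter.Eventually.of_forall hpt)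
    _ = ∫ z, (∫ u, f u z) ∂ρ := integral_integral_swap hI
    _ ≤ ∫ _z, (Real.sqrt (4 * Real.pi * Real.exp 1) * (Real.sqrt Real.pi * Real.pi)) ^ n *
        ((t / (γ * Real.sqrt b)) ^ n + Real.exp (-(b * α ^ 2))) ∂ρ := by
        refine integral_mono_ae hI.integral_prod_right (integrable_const _) ?_
        filter_upwards [ae_cond_mem hTm] with z hz
        exact integral_exp_neg_infDist_mul_gaussian_le hn hb hα hγ hγ1 hA ht htD hz
    _ = _ := by simp

end

/-! ### Quasi-norms and the smoothing bound for their unit balls. -/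

section

variable {n : ℕ} {q : EuclideanSpace ℝ (Fin n) → ℝ} {CK : ℝ}

theorem IsQuasiNorm.one_le (hq : IsQuasiNorm q CK) (hn : 1 ≤ n) : 1 ≤ CK := by
  set e : EuclideanSpace ℝ (Fin n) := EuclideanSpace.single ⟨0, hn⟩ 1
  have he : q e ≠ 0 := fun h => by
    have h1 := (hq.eq_zero_iff e).1 h
    have h2 : ‖e‖ = 1 := by simp [e]
    simp [h1] at h2
  have h0 : q 0 = 0 := (hq.eq_zero_iff 0).2 rfl
  have h1 := hq.add_le e 0
  rw [add_zero, h0, add_zero] at h1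
  have h2 : 0 < q e := lt_of_le_of_ne (hq.nonneg e) he.symm
  nlinarith

theorem IsQuasiNorm.exists_sum_le (hq : IsQuasiNorm q CK) (hn : 1 ≤ n) {ι : Type*} (s : Finset ι)
    (e : ι → EuclideanSpace ℝ (Fin n)) :
    ∃ M, 0 ≤ M ∧ ∀ (c : ι → ℝ) (r : ℝ), (∀ i ∈ s, |c i| ≤ r) → 0 ≤ r →
      q (∑ i ∈ s, c i • e i) ≤ M * r := by
  classical
  have hC := hq.one_le hn
  induction s using Finset.induction_on with
  | empty => exact ⟨0, le_rfl, fun c r _ _ => by simp [(hq.eq_zero_iff 0).2 rfl]⟩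
  | insert a s ha ih =>
    obtain ⟨M, hM0, hM⟩ := ih
    refine ⟨CK * (q (e a) + M), mul_nonneg (by linarith) (add_nonneg (hq.nonneg _) hM0),
      fun c r hc hr => ?_⟩
    rw [Finset.sum_insert ha, mul_assoc]
    refine (hq.add_le _ _).trans (mul_le_mul_of_nonneg_left ?_ (by linarith))
    rw [hq.smul, add_mul, mul_comm (q (e a))]
    exact add_le_add (mul_le_mul_of_nonneg_right (hc a (Finset.mem_insert_self _ _)) (hq.nonneg _))
      (hM c r (fun i hi => hc i (Finset.mem_insert_of_mem hi)) hr)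

theorem IsQuasiNorm.exists_le_norm (hq : IsQuasiNorm q CK) (hn : 1 ≤ n) :
    ∃ M, 0 < M ∧ ∀ x, q x ≤ M * ‖x‖ := by
  obtain ⟨M, hM0, hM⟩ := hq.exists_sum_le hn Finset.univ
    (fun i : Fin n => EuclideanSpace.single i (1 : ℝ))
  refine ⟨M + 1, by linarith, fun x => ?_⟩
  have h1 := hM (fun i => x i) ‖x‖ (fun i _ => PiLp.norm_apply_le x i) (norm_nonneg x)
  have h2 : ∑ i, x i • EuclideanSpace.single i (1 : ℝ) = x := by
    ext j
    simp [Finset.sum_apply, Pi.single_apply]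
  rw [h2] at h1
  nlinarith [norm_nonneg x]

/-- A quasi-norm need not be continuous, so its minimum on the sphere may not be attained. Instead,
if `q (x k) → 0` on the sphere, a limit point `a` satisfies `q a = 0` by the quasi-triangle
inequality and the upper bound `q ≤ M‖·‖`. -/
theorem IsQuasiNorm.exists_norm_le (hq : IsQuasiNorm q CK) (hn : 1 ≤ n) :
    ∃ ε, 0 < ε ∧ ∀ x, ε * ‖x‖ ≤ q x := by
  obtain ⟨M, hM, hqM⟩ := hq.exists_le_norm hn
  have hC := hq.one_le hn
  have hsphere : ∃ ε, 0 < ε ∧ ∀ x : EuclideanSpace ℝ (Fin n), ‖x‖ = 1 → ε ≤ q x := by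
    by_contra! h
    choose x hx1 hx2 using fun k : ℕ => h (1 / ((k : ℝ) + 1)) (by positivity)
    obtain ⟨a, ha, φ, hφ, hlim⟩ := (isCompact_sphere (0 : EuclideanSpace ℝ (Fin n)) 1).tendsto_subseq
      (x := x) fun k => by simp [hx1 k]
    have h1 : ∀ k, q a ≤ CK * (M * ‖a - x (φ k)‖ + 1 / ((φ k : ℝ) + 1)) := fun k => by
      have := hq.add_le (a - x (φ k)) (x (φ k))
      rw [sub_add_cancel] at this
      refine this.trans (mul_le_mul_of_nonneg_left (add_le_add (hqM _) (hx2 _).le) (by linarith))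
    have h2 : Filter.Tendsto (fun k => CK * (M * ‖a - x (φ k)‖ + 1 / ((φ k : ℝ) + 1)))
        Filter.atTop (nhds (CK * (M * ‖a - a‖ + 0))) :=
      ((((tendsto_const_nhds.sub hlim).norm).const_mul M).add
        (tendsto_one_div_add_atTop_nhds_zero_nat.comp hφ.tendsto_atTop)).const_mul CK
    have h3 := ge_of_tendsto' h2 h1
    simp only [sub_self, norm_zero, mul_zero, add_zero] at h3
    have h4 := (hq.eq_zero_iff a).1 (le_antisymm h3 (hq.nonneg a))
    simp [h4] at ha
  obtain ⟨ε, hε, h⟩ := hsphere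
  refine ⟨ε, hε, fun x => ?_⟩
  by_cases hx : x = 0
  · simp [hx, (hq.eq_zero_iff 0).2 rfl]
  have hx0 : 0 < ‖x‖ := norm_pos_iff.2 hx
  have h1 := h (‖x‖⁻¹ • x) (by rw [norm_smul, norm_inv, norm_norm, inv_mul_cancel₀ hx0.ne'])
  rw [hq.smul, abs_of_pos (by positivity), le_inv_mul_iff₀ hx0] at h1
  linarith

theorem IsQuasiNorm.volume_quasiBall_ne_top (hq : IsQuasiNorm q CK) (hn : 1 ≤ n) :
    volume (quasiBall q) ≠ ⊤ := by
  obtain ⟨ε, hε, h⟩ := hq.exists_norm_le hn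
  refine ((measure_mono fun x hx => ?_).trans_lt
    (measure_closedBall_lt_top (x := (0 : EuclideanSpace ℝ (Fin n))) (r := 1 / ε))).ne
  rw [mem_closedBall_zero_iff, le_div_iff₀ hε, mul_comm]
  exact (h x).trans hx

theorem IsQuasiNorm.stdGaussian_quasiBall_pos (hq : IsQuasiNorm q CK) (hn : 1 ≤ n) :
    0 < (stdGaussian (EuclideanSpace ℝ (Fin n))).real (quasiBall q) := by
  obtain ⟨M, hM, h⟩ := hq.exists_le_norm hn
  have hsub : Metric.ball (0 : EuclideanSpace ℝ (Fin n)) (1 / M) ⊆ quasiBall q := fun x hx => by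
    rw [mem_ball_zero_iff, lt_div_iff₀ hM, mul_comm] at hx
    exact (h x).trans hx.le
  have hpos : stdGaussian (EuclideanSpace ℝ (Fin n)) (quasiBall q) ≠ 0 := fun h0 => by
    have h1 := measure_mono_null hsub h0
    rw [stdGaussian_eq_withDensity, withDensity_apply _ Metric.isOpen_ball.measurableSet,
      lintegral_eq_zero_iff (by fun_prop)] at h1
    have h2 : ∀ᵐ x ∂(volume.restrict (Metric.ball (0 : EuclideanSpace ℝ (Fin n)) (1 / M))),
        False := by
      filter_upwards [h1] with x hx
      simp only [Pi.zero_apply, ENNReal.ofReal_eq_zero] at hx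
      have : 0 < (Real.sqrt (2 * Real.pi) ^ n)⁻¹ * Real.exp (-(1 / 2) * ‖x‖ ^ 2) := by positivity
      linarith
    rw [Filter.eventually_false_iff_eq_bot, ae_eq_bot, Measure.restrict_eq_zero] at h2
    exact (Metric.measure_ball_pos volume _ (by positivity)).ne' h2
  exact ENNReal.toReal_pos hpos (measure_ne_top _ _)

theorem IsQuasiNorm.setOf_le_eq_smul_quasiBall (hq : IsQuasiNorm q CK) {r : ℝ} (hr : 0 < r) :
    {x | q x ≤ r} = (fun x => r • x) '' quasiBall q := by
  ext x
  refine ⟨fun hx => ⟨r⁻¹ • x, ?_, smul_inv_smul₀ hr.ne' x⟩, ?_⟩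
  · change q (r⁻¹ • x) ≤ 1
    rw [hq.smul, abs_of_pos (by positivity), inv_mul_le_iff₀ hr, mul_one]
    exact hx
  · rintro ⟨y, hy, rfl⟩
    change q (r • y) ≤ r
    rw [hq.smul, abs_of_pos hr]
    exact mul_le_of_le_one_right hr.le hy

theorem IsQuasiNorm.volume_setOf_le (hq : IsQuasiNorm q CK) {r : ℝ} (hr : 0 < r) :
    volume {x | q x ≤ r} = ENNReal.ofReal (r ^ n) * volume (quasiBall q) := by
  rw [hq.setOf_le_eq_smul_quasiBall hr, Set.image_smul, Measure.addHaar_smul,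
    finrank_euclideanSpace_fin, abs_of_pos (by positivity)]

theorem IsQuasiNorm.measureReal_quasiBall_le (hq : IsQuasiNorm q CK) (hn : 1 ≤ n) (hqm : Measurable q)
    (μ : Measure (EuclideanSpace ℝ (Fin n))) [IsProbabilityMeasure μ] {I : ℝ}
    (hI : ∫ u, ‖charFun μ u‖ * Real.exp (-(1 / 2) * ‖u‖ ^ 2) ≤ I) :
    μ.real (quasiBall q) ≤ volume.real (quasiBall q) /
      (stdGaussian (EuclideanSpace ℝ (Fin n))).real (quasiBall q) * (CK / Real.pi) ^ n * I := by
  have hC := hq.one_le hn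
  have hr : 0 < 2 * CK := by linarith
  have hvol := hq.volume_setOf_le hr
  have h1 := measureReal_mul_stdGaussian_le μ (U := quasiBall q) (S := quasiBall q)
    (W := {x | q x ≤ 2 * CK}) (measurableSet_le hqm measurable_const)
    (by rw [hvol]; exact ENNReal.mul_ne_top ENNReal.ofReal_ne_top (hq.volume_quasiBall_ne_top hn))
    (fun x hx s hs => by
      have h2 : q x ≤ 1 := hx
      have h3 : q s ≤ 1 := hs
      change q (x + s) ≤ 2 * CK
      nlinarith [hq.add_le x s])
  have hG := hq.stdGaussian_quasiBall_pos hn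
  rw [Measure.real, Measure.real, Measure.real, hvol, ENNReal.toReal_mul,
    ENNReal.toReal_ofReal (by positivity)] at h1
  change μ.real (quasiBall q) * (stdGaussian (EuclideanSpace ℝ (Fin n))).real (quasiBall q) ≤
    (2 * CK) ^ n * volume.real (quasiBall q) * _ at h1
  rw [← le_div_iff₀ hG] at h1
  refine h1.trans ?_
  have h4 : (2 * CK) ^ n * volume.real (quasiBall q) * (((2 * Real.pi) ^ n)⁻¹ *
      ∫ u, ‖charFun μ u‖ * Real.exp (-(1 / 2) * ‖u‖ ^ 2)) /
        (stdGaussian (EuclideanSpace ℝ (Fin n))).real (quasiBall q) =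
      volume.real (quasiBall q) / (stdGaussian (EuclideanSpace ℝ (Fin n))).real (quasiBall q) *
        (CK / Real.pi) ^ n * ∫ u, ‖charFun μ u‖ * Real.exp (-(1 / 2) * ‖u‖ ^ 2) := by
    rw [mul_pow, mul_pow, div_pow]
    field_simp
  rw [h4]
  refine mul_le_mul_of_nonneg_left hI (mul_nonneg (by positivity) ?_)
  have := Real.pi_pos
  exact pow_nonneg (div_nonneg (by linarith) this.le) _

end

/-! ### Cubes and the covering of the `ℓ_p` ball. -/

theorem le_stdGaussian_real_supCube (n : ℕ) :
    (2 / Real.sqrt (2 * Real.pi * Real.exp 1)) ^ n ≤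
      (stdGaussian (EuclideanSpace ℝ (Fin n))).real (supCube n 1) := by
  have hQ := isCompact_supCube n zero_le_one
  set c : ℝ := (Real.sqrt (2 * Real.pi) ^ n)⁻¹ * Real.exp (-(1 / 2) * n) with hc
  have hc0 : 0 ≤ c := by positivity
  have h1 : ENNReal.ofReal c * volume (supCube n 1) ≤
      stdGaussian (EuclideanSpace ℝ (Fin n)) (supCube n 1) := by
    rw [stdGaussian_eq_withDensity, withDensity_apply _ hQ.measurableSet, ← setLIntegral_const]
    refine setLIntegral_mono (by fun_prop) fun x hx => ENNReal.ofReal_le_ofReal ?_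
    have h2 := norm_sq_le_of_mem_supCube hx
    rw [hc]
    gcongr ?_ * Real.exp ?_
    linarith
  have h3 := ENNReal.toReal_mono (measure_ne_top _ _) h1
  rw [ENNReal.toReal_mul, ENNReal.toReal_ofReal hc0] at h3
  change c * volume.real (supCube n 1) ≤ _ at h3
  rw [volume_real_supCube n zero_le_one] at h3
  refine le_trans (le_of_eq ?_) h3
  have h4 : Real.exp (-(1 / 2) * n) = (Real.sqrt (Real.exp 1) ^ n)⁻¹ := by
    rw [← Real.exp_half, ← Real.exp_nat_mul, ← Real.exp_neg]
    congr 1; ring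
  rw [hc, h4, Real.sqrt_mul (by positivity), div_pow, mul_pow, mul_one]
  field_simp

theorem measureReal_translate_supCube_le {n : ℕ} (μ : Measure (EuclideanSpace ℝ (Fin n)))
    [IsProbabilityMeasure μ] {I : ℝ}
    (hI : ∫ u, ‖charFun μ u‖ * Real.exp (-(1 / 2) * ‖u‖ ^ 2) ≤ I) (m : EuclideanSpace ℝ (Fin n)) :
    μ.real {x | x - m ∈ supCube n 1} ≤ (Real.sqrt (2 * Real.pi * Real.exp 1) / Real.pi) ^ n * I := by
  have hvol : volume {x | x - m ∈ supCube n 2} = volume (supCube n 2) :=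
    (measurePreserving_sub_right volume m).measure_preimage
      (isClosed_supCube n 2).measurableSet.nullMeasurableSet
  have h1 := measureReal_mul_stdGaussian_le μ (U := {x | x - m ∈ supCube n 1}) (S := supCube n 1)
    (W := {x | x - m ∈ supCube n 2})
    ((isClosed_supCube n 2).preimage (continuous_id.sub continuous_const)).measurableSet
    (by rw [hvol]; exact (isCompact_supCube n zero_le_two).measure_lt_top.ne)
    (fun x hx s hs i => by
      have h2 := hx i
      have h3 := hs i
      have h4 : (x + s - m) i = (x - m) i + s i := by simp; ring
      rw [h4]
      linarith [abs_add_le ((x - m) i) (s i)])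
  have h5 : volume.real {x | x - m ∈ supCube n 2} = 4 ^ n := by
    rw [Measure.real, hvol]
    change volume.real (supCube n 2) = _
    rw [volume_real_supCube n zero_le_two]; norm_num
  rw [h5] at h1
  have h6 := (mul_le_mul_of_nonneg_left (le_stdGaussian_real_supCube n) measureReal_nonneg).trans h1
  have h7 : 0 ≤ ∫ u, ‖charFun μ u‖ * Real.exp (-(1 / 2) * ‖u‖ ^ 2) :=
    integral_nonneg fun u => by positivity
  rw [← le_div_iff₀ (by positivity)] at h6
  refine h6.trans (le_trans (le_of_eq ?_) (mul_le_mul_of_nonneg_left hI (by positivity)))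
  rw [div_pow, div_pow, mul_pow 2 Real.pi, show (4 : ℝ) = 2 * 2 by norm_num, mul_pow]
  field_simp

/-- The maximum of `log y / y` is `1/e`, and `3/(2e) < log 2`. Any exponent above `1` would serve
the later summation; `3/2` is small enough for base `2`. -/
theorem rpow_three_halves_le_two_rpow {y : ℝ} (hy : 0 < y) : y ^ (3 / 2 : ℝ) ≤ 2 ^ y := by
  have h2 := Real.log_two_gt_d9
  set c := 2 / 3 * Real.log 2 with hc
  have hc0 : 0 < c := by positivity
  have h1 : -1 ≤ Real.log c := by
    rw [Real.le_log_iff_exp_le hc0]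
    have := Real.exp_neg_one_lt_d9
    linarith
  have h3 := Real.log_le_sub_one_of_pos (mul_pos hy hc0)
  rw [Real.log_mul hy.ne' hc0.ne'] at h3
  rw [Real.rpow_def_of_pos hy, Real.rpow_def_of_pos two_pos, Real.exp_le_exp]
  have h4 : y * c = 2 / 3 * (Real.log 2 * y) := by rw [hc]; ring
  linarith

theorem two_rpow_weight_le {p : ℝ} (hp : 0 < p) (k : ℤ) :
    (2 : ℝ) ^ ((1 - |(k : ℝ)| ^ p) / p) ≤
      2 ^ (1 / p) * ((if k = 0 then 1 else 0) + |(k : ℝ)| ^ (-(3 / 2) : ℝ)) := by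
  by_cases hk : k = 0
  · subst hk
    -- Here `0 ^ (-3/2) = 0` by convention, so the indicator of `k = 0` supplies the whole bound.
    simp [Real.zero_rpow hp.ne', Real.zero_rpow (show (-(3 / 2) : ℝ) ≠ 0 by norm_num)]
  have hk0 : 0 < |(k : ℝ)| := abs_pos.2 (by exact_mod_cast hk)
  set y := |(k : ℝ)| ^ p with hy
  have hy0 : 0 < y := Real.rpow_pos_of_pos hk0 p
  have hky : |(k : ℝ)| ^ (3 / 2 : ℝ) = (y ^ (3 / 2 : ℝ)) ^ (1 / p) := by
    rw [hy, ← Real.rpow_mul hk0.le, ← Real.rpow_mul hk0.le]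
    congr 1; field_simp
  have h1 : |(k : ℝ)| ^ (3 / 2 : ℝ) ≤ 2 ^ (y / p) := by
    rw [hky, show y / p = y * (1 / p) by ring, Real.rpow_mul zero_le_two]
    exact Real.rpow_le_rpow (by positivity) (rpow_three_halves_le_two_rpow hy0) (by positivity)
  rw [if_neg hk, zero_add, sub_div, Real.rpow_sub two_pos, Real.rpow_neg hk0.le, div_eq_mul_inv]
  refine mul_le_mul_of_nonneg_left ?_ (by positivity)
  exact inv_anti₀ (Real.rpow_pos_of_pos hk0 _) h1

/-- An exponential Markov bound: each counted point has weight `2 ^ ((n - ∑ |m_j|^p) / p) ≥ 1`, and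
the total weight factors over coordinates. The one-dimensional sum is `2^(1/p)` times a constant
free of `p` and `T`. -/
theorem card_filter_sum_rpow_le {n : ℕ} {p : ℝ} (hp : 0 < p) (T : Finset ℤ) :
    (((Fintype.piFinset fun _ : Fin n => T).filter
      fun m => ∑ j, |(m j : ℝ)| ^ p ≤ n).card : ℝ) ≤
      (2 ^ (1 / p) * (1 + ∑' k : ℤ, |(k : ℝ)| ^ (-(3 / 2) : ℝ))) ^ n := by
  have hsum : Summable fun k : ℤ => |(k : ℝ)| ^ (-(3 / 2) : ℝ) :=
    Real.summable_abs_int_rpow (by norm_num)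
  set L := (Fintype.piFinset fun _ : Fin n => T).filter fun m => ∑ j, |(m j : ℝ)| ^ p ≤ n with hL
  have hT : ∑ k ∈ T, (2 : ℝ) ^ ((1 - |(k : ℝ)| ^ p) / p) ≤
      2 ^ (1 / p) * (1 + ∑' k : ℤ, |(k : ℝ)| ^ (-(3 / 2) : ℝ)) := by
    refine (Finset.sum_le_sum fun k _ => two_rpow_weight_le hp k).trans ?_
    rw [← Finset.mul_sum, Finset.sum_add_distrib]
    gcongr
    · rw [Finset.sum_ite_eq']
      split_ifs <;> norm_num
    · exact hsum.sum_le_tsum T fun k _ => by positivity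
  calc (L.card : ℝ) = ∑ _m ∈ L, (1 : ℝ) := by simp
    _ ≤ ∑ m ∈ L, ∏ j, (2 : ℝ) ^ ((1 - |(m j : ℝ)| ^ p) / p) := by
        refine Finset.sum_le_sum fun m hm => ?_
        have h1 : ∑ j, |(m j : ℝ)| ^ p ≤ n := (Finset.mem_filter.1 hm).2
        rw [← Real.rpow_sum_of_pos two_pos, ← Finset.sum_div, Finset.sum_sub_distrib]
        refine Real.one_le_rpow one_le_two (div_nonneg ?_ hp.le)
        simpa using h1
    _ ≤ ∑ m ∈ Fintype.piFinset fun _ : Fin n => T,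
          ∏ j, (2 : ℝ) ^ ((1 - |(m j : ℝ)| ^ p) / p) :=
        Finset.sum_le_sum_of_subset_of_nonneg (Finset.filter_subset _ _)
          fun m _ _ => Finset.prod_nonneg fun j _ => by positivity
    _ = ∏ _j : Fin n, ∑ k ∈ T, (2 : ℝ) ^ ((1 - |(k : ℝ)| ^ p) / p) :=
        (Finset.prod_univ_sum (fun _ : Fin n => T) fun _ k =>
          (2 : ℝ) ^ ((1 - |(k : ℝ)| ^ p) / p)).symm
    _ = (∑ k ∈ T, (2 : ℝ) ^ ((1 - |(k : ℝ)| ^ p) / p)) ^ n := by simp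
    _ ≤ _ := pow_le_pow_left₀ (Finset.sum_nonneg fun k _ => by positivity) hT n

theorem exists_int_abs_le_abs_sub_le_one (x : ℝ) : ∃ m : ℤ, |(m : ℝ)| ≤ |x| ∧ |x - m| ≤ 1 := by
  rcases le_total 0 x with h | h
  · refine ⟨⌊x⌋, ?_, ?_⟩
    · rw [abs_of_nonneg h, abs_of_nonneg (by exact_mod_cast Int.floor_nonneg.2 h)]
      exact Int.floor_le x
    · rw [abs_le]
      constructor <;> linarith [Int.floor_le x, Int.lt_floor_add_one x]
  · refine ⟨⌈x⌉, ?_, ?_⟩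
    · rw [abs_of_nonpos h, abs_of_nonpos (by exact_mod_cast Int.ceil_le.2 (by simpa using h))]
      exact neg_le_neg (Int.le_ceil x)
    · rw [abs_le]
      constructor <;> linarith [Int.le_ceil x, Int.ceil_lt_add_one x]

theorem measureReal_sum_rpow_le {n : ℕ} (μ : Measure (EuclideanSpace ℝ (Fin n)))
    [IsProbabilityMeasure μ] {I : ℝ} (hI0 : 0 ≤ I)
    (hI : ∫ u, ‖charFun μ u‖ * Real.exp (-(1 / 2) * ‖u‖ ^ 2) ≤ I) {p : ℝ} (hp : 0 < p) :
    μ.real {x | ∑ j, |x j| ^ p ≤ n} ≤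
      (2 ^ (1 / p) * (1 + ∑' k : ℤ, |(k : ℝ)| ^ (-(3 / 2) : ℝ))) ^ n *
        ((Real.sqrt (2 * Real.pi * Real.exp 1) / Real.pi) ^ n * I) := by
  -- `M` only makes the set of centres finite; the count does not depend on it.
  set M : ℤ := ⌈(n : ℝ) ^ (1 / p)⌉ with hM
  set L := (Fintype.piFinset fun _ : Fin n => Finset.Icc (-M) M).filter
    fun m => ∑ j, |(m j : ℝ)| ^ p ≤ n with hL
  have hcover : {x : EuclideanSpace ℝ (Fin n) | ∑ j, |x j| ^ p ≤ n} ⊆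
      ⋃ m ∈ L, {x | x - (WithLp.toLp 2 fun j => (m j : ℝ)) ∈ supCube n 1} := by
    intro x hx
    -- Rounding towards zero keeps the centre inside the same `ℓ_p` ball.
    choose m hm1 hm2 using fun j => exists_int_abs_le_abs_sub_le_one (x j)
    have h1 : ∑ j, |(m j : ℝ)| ^ p ≤ n :=
      (Finset.sum_le_sum fun j _ => Real.rpow_le_rpow (abs_nonneg _) (hm1 j) hp.le).trans hx
    have h2 : ∀ j, |(m j : ℝ)| ≤ M := by
      intro j
      have h3 : |(m j : ℝ)| ^ p ≤ n :=
        (Finset.single_le_sum (f := fun j => |(m j : ℝ)| ^ p) (fun i _ => by positivity)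
          (Finset.mem_univ j)).trans h1
      have h4 : |(m j : ℝ)| ≤ (n : ℝ) ^ (1 / p) := by
        rw [one_div]
        exact (Real.le_rpow_inv_iff_of_pos (abs_nonneg _) (by positivity) hp).2 h3
      exact h4.trans (Int.le_ceil _)
    refine Set.mem_iUnion₂.2 ⟨m, Finset.mem_filter.2 ⟨Fintype.mem_piFinset.2 fun j => ?_, h1⟩,
      fun j => by simpa using hm2 j⟩
    rw [Finset.mem_Icc, ← abs_le]
    exact_mod_cast h2 j
  calc μ.real {x | ∑ j, |x j| ^ p ≤ n}
      ≤ μ.real (⋃ m ∈ L, {x | x - (WithLp.toLp 2 fun j => (m j : ℝ)) ∈ supCube n 1}) :=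
        measureReal_mono hcover (measure_ne_top _ _)
    _ ≤ ∑ m ∈ L, μ.real {x | x - (WithLp.toLp 2 fun j => (m j : ℝ)) ∈ supCube n 1} :=
        measureReal_biUnion_finset_le _ _
    _ ≤ ∑ _m ∈ L, (Real.sqrt (2 * Real.pi * Real.exp 1) / Real.pi) ^ n * I :=
        Finset.sum_le_sum fun m _ => measureReal_translate_supCube_le μ hI _
    _ = L.card * ((Real.sqrt (2 * Real.pi * Real.exp 1) / Real.pi) ^ n * I) := by
        rw [Finset.sum_const, nsmul_eq_mul]
    _ ≤ _ := mul_le_mul_of_nonneg_right (card_filter_sum_rpow_le hp _)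
        (mul_nonneg (pow_nonneg (div_nonneg (by positivity) Real.pi_pos.le) _) hI0)

theorem sum_rpow_inv_smul_le_of_lpQuasiNorm_le {n : ℕ} {p t : ℝ} (hp : 0 < p) (ht : 0 < t)
    {x : EuclideanSpace ℝ (Fin n)} (hx : lpQuasiNorm p x ≤ t * (n : ℝ) ^ (1 / p)) :
    ∑ j, |(t⁻¹ • x) j| ^ p ≤ n := by
  have h0 : 0 ≤ ∑ j, |x j| ^ p := Finset.sum_nonneg fun j _ => by positivity
  have h1 : ∑ j, |(t⁻¹ • x) j| ^ p = (t ^ p)⁻¹ * ∑ j, |x j| ^ p := by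
    rw [Finset.mul_sum]
    refine Finset.sum_congr rfl fun j _ => ?_
    rw [PiLp.smul_apply, smul_eq_mul, abs_mul, abs_of_pos (inv_pos.2 ht),
      Real.mul_rpow (by positivity) (abs_nonneg _), Real.inv_rpow ht.le]
  rw [lpQuasiNorm] at hx
  have h2 := Real.rpow_le_rpow (by positivity) hx hp.le
  rw [Real.mul_rpow ht.le (by positivity), ← Real.rpow_mul h0, ← Real.rpow_mul (by positivity),
    one_div_mul_cancel hp.ne', Real.rpow_one, Real.rpow_one] at h2
  rw [h1, inv_mul_le_iff₀ (by positivity)]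
  exact h2

theorem aemeasurable_loSum {n N : ℕ} (A : Matrix (Fin N) (Fin n) ℝ) {Ω : Type*}
    [MeasurableSpace Ω] {P : Measure Ω} {δ : Fin N → Ω → ℝ} (hδ : ∀ k, AEMeasurable (δ k) P) :
    AEMeasurable (loSum A δ) P := by
  unfold loSum
  exact Finset.aemeasurable_fun_sum _ fun k _ => (hδ k).smul_const _

theorem theorem3p1 :
    ∃ C : ℝ, 0 < C ∧
      ∀ (n N : ℕ) (_ : 1 ≤ n) (A : Matrix (Fin N) (Fin n) ℝ)
        (Ω : Type*) [MeasurableSpace Ω] (P : Measure Ω) [IsProbabilityMeasure P]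
        (δ : Fin N → Ω → ℝ) (b α γ t : ℝ),
        iIndepFun δ P →
        (∀ k l, IdentDistrib (δ k) (δ l) P P) →
        0 < b → b < 1 →
        (∀ k, ∀ x : ℝ, P.real {ω | |δ k ω - x| ≤ 1} ≤ 1 - b) →
        0 < α → 0 < γ → γ < 1 →
        (∀ θ : EuclideanSpace ℝ (Fin n), ‖θ‖ ≤ ‖euclMulVec A θ‖) →
        Real.sqrt n / LCD α γ A ≤ t →
        (∀ (q : EuclideanSpace ℝ (Fin n) → ℝ) (CK : ℝ), IsQuasiNorm q CK → Measurable q →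
          P.real {ω | q (loSum A δ ω) ≤ t} ≤
            volume.real (quasiBall q) /
                (stdGaussian (EuclideanSpace ℝ (Fin n))).real (quasiBall q) *
              (C * CK / Real.pi) ^ n *
              ((t / (γ * Real.sqrt b)) ^ n + Real.exp (-(b * α ^ 2)))) ∧
        (∀ p : ℝ, 0 < p →
          P.real {ω | lpQuasiNorm p (loSum A δ ω) ≤ t * (n : ℝ) ^ (1 / p)} ≤
            (C * max ((2 : ℝ) ^ (1 / p - 1)) 1) ^ n *
              ((t / (γ * Real.sqrt b)) ^ n + Real.exp (-(b * α ^ 2)))) := by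
  have hpi := Real.pi_pos
  set C₀ : ℝ := Real.sqrt (4 * Real.pi * Real.exp 1) * (Real.sqrt Real.pi * Real.pi) with hC₀
  set C₁ : ℝ := Real.sqrt (2 * Real.pi * Real.exp 1) / Real.pi with hC₁
  set S : ℝ := 1 + ∑' k : ℤ, |(k : ℝ)| ^ (-(3 / 2) : ℝ) with hS
  have hC₀0 : 0 < C₀ := by positivity
  have hC₁0 : 0 < C₁ := by positivity
  have hS0 : 0 < S := by
    have : 0 ≤ ∑' k : ℤ, |(k : ℝ)| ^ (-(3 / 2) : ℝ) := tsum_nonneg fun k => by positivity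
    linarith
  have hCC : 0 < 2 * S * C₁ * C₀ := by positivity
  -- `C₀` suffices for (i) and `2 * S * C₁ * C₀` for (ii).
  refine ⟨C₀ + 2 * S * C₁ * C₀, by positivity, ?_⟩
  intro n N hn A Ω _ P _ δ b α γ t hind hident hb hb1 hconc hα hγ hγ1 hA hLt
  have hD : 0 < LCD α γ A := LCD_pos hn hα hγ hγ1 hA
  have ht : 0 < t := lt_of_lt_of_le
    (div_pos (Real.sqrt_pos.2 (by exact_mod_cast hn)) hD) hLt
  have htD : Real.sqrt n ≤ t * LCD α γ A := (div_le_iff₀ hD).1 hLt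
  have hδ : ∀ k, AEMeasurable (δ k) P := fun k => (hident k k).aemeasurable_fst
  -- For `N = 0` every `Aθ` vanishes, contradicting `|Aθ| ≥ |θ|`; an index is needed to name the
  -- common law.
  obtain ⟨k₀⟩ : Nonempty (Fin N) := by
    by_contra hN
    rw [not_nonempty_iff] at hN
    have h1 := hA (EuclideanSpace.single ⟨0, hn⟩ 1)
    have h2 : ‖euclMulVec A (EuclideanSpace.single ⟨0, hn⟩ 1)‖ = 0 := by
      rw [norm_eq_zero]; exact Subsingleton.elim _ _
    rw [h2] at h1
    simp only [PiLp.norm_single, norm_one] at h1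
    linarith
  have hX : AEMeasurable (fun ω => t⁻¹ • loSum A δ ω) P := (aemeasurable_loSum A hδ).const_smul t⁻¹
  have : IsProbabilityMeasure (P.map (δ k₀)) := Measure.isProbabilityMeasure_map (hδ k₀)
  set μ := P.map fun ω => t⁻¹ • loSum A δ ω with hμ
  have : IsProbabilityMeasure μ := Measure.isProbabilityMeasure_map hX
  set J : ℝ := (t / (γ * Real.sqrt b)) ^ n + Real.exp (-(b * α ^ 2)) with hJ
  have hJ0 : 0 ≤ J := by positivity
  have hI : ∫ u, ‖charFun μ u‖ * Real.exp (-(1 / 2) * ‖u‖ ^ 2) ≤ C₀ ^ n * J :=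
    integral_norm_charFun_loSum_le hn hind hδ (P.map (δ k₀)) (fun k => (hident k k₀).map_eq) hb hb1
      (fun x => by
        rw [map_measureReal_apply_of_aemeasurable (hδ k₀)
          (measurableSet_le (by fun_prop) measurable_const)]
        exact hconc k₀ x) hα hγ hγ1 hA ht htD
  constructor
  · intro q CK hq hqm
    have hset : {ω | q (loSum A δ ω) ≤ t} =
        (fun ω => t⁻¹ • loSum A δ ω) ⁻¹' quasiBall q := by
      ext ω
      change q (loSum A δ ω) ≤ t ↔ q (t⁻¹ • loSum A δ ω) ≤ 1
      rw [hq.smul, abs_of_pos (inv_pos.2 ht), inv_mul_le_iff₀ ht, mul_one]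
    have hCK := hq.one_le hn
    rw [hset, ← map_measureReal_apply_of_aemeasurable hX (s := quasiBall q)
      (measurableSet_le hqm measurable_const)]
    refine (hq.measureReal_quasiBall_le hn hqm μ hI).trans ?_
    rw [← mul_assoc, mul_assoc (_ / _) (_ ^ n) (_ ^ n), ← mul_pow]
    refine mul_le_mul_of_nonneg_right (mul_le_mul_of_nonneg_left ?_ (by positivity)) hJ0
    refine pow_le_pow_left₀ (by positivity) ?_ n
    rw [div_mul_eq_mul_div, mul_comm CK]
    gcongr
    linarith
  · intro p hp
    have hset : {ω | lpQuasiNorm p (loSum A δ ω) ≤ t * (n : ℝ) ^ (1 / p)} ⊆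
        (fun ω => t⁻¹ • loSum A δ ω) ⁻¹' {x | ∑ j, |x j| ^ p ≤ n} := fun ω hω =>
      sum_rpow_inv_smul_le_of_lpQuasiNorm_le hp ht hω
    refine (measureReal_mono hset).trans ?_
    rw [← map_measureReal_apply_of_aemeasurable hX (measurableSet_le (by fun_prop) measurable_const)]
    refine (measureReal_sum_rpow_le μ (by positivity) hI hp).trans ?_
    rw [← mul_assoc, ← mul_assoc, ← mul_pow, ← mul_pow]
    refine mul_le_mul_of_nonneg_right (pow_le_pow_left₀ (by positivity) ?_ n) hJ0
    have h2 : (2 : ℝ) ^ (1 / p) ≤ 2 * max ((2 : ℝ) ^ (1 / p - 1)) 1 := by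
      refine le_trans (le_of_eq ?_) (mul_le_mul_of_nonneg_left (le_max_left _ _) zero_le_two)
      rw [Real.rpow_sub_one two_ne_zero]; ring
    calc 2 ^ (1 / p) * S * C₁ * C₀ ≤ 2 * max ((2 : ℝ) ^ (1 / p - 1)) 1 * S * C₁ * C₀ := by gcongr
      _ = 2 * S * C₁ * C₀ * max ((2 : ℝ) ^ (1 / p - 1)) 1 := by ring
      _ ≤ _ := by gcongr; linarith
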